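/- Let $m_1,m_2,m_3>0$ and $a>0$, and consider the planar three-body problem with potential function $U(q)=\frac1a\sum_{j<k}\frac{m_jm_k}{|q_j-q_k|^{a}}$, that is, $m_k\dot q_k=p_k$, $\dot p_k=g_k(q):=\sum_{j\ne k}\frac{m_jm_k}{|q_j-q_k|^{a+2}}(q_j-q_k)$, with $q_k(t)\in\mathbb C=\mathbb R^2$ pairwise distinct and $\sum_k m_kq_k=0$. Put $I=\sum_k m_k|q_k|^2$, $T=\frac12\sum_k |p_k|^2/m_k$, $H=T-U$, $C=\sum_k q_k\wedge p_k$ (where $z\wedge w=\operatorname{Im}(\bar z w)$), and $\mu=U I^{a/2}$ (the configurational measure). For a solution on which $\mu$ is constant, let $B$ be the constant of the motion defined by $$\tfrac12\Big(\frac{dI}{dt}\Big)^2-4HI-4\mu I^{(2-a)/2}=-2B .$$ A configuration $q$ (three pairwise distinct points with $\sum_k m_kq_k=0$) is called central if, with $Q=q/\sqrt{I(q)}$, one has $g_k(Q)+a\,\mu(Q)\,m_kQ_k=0$ for $k=1,2,3$. Let $q^0$ be a configuration that is not central. Then there is a $\delta>0$, depending only on $q^0$ (and on $m_1,m_2,m_3,a$),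 such that there is no solution of the planar three-body problem, on any open time interval containing the initial time $t_0$, with constant configurational measure, with $q(t_0)=q^0$, and with $0<B-C^2<\delta$. -/

import Mathlib

noncomputable section

namespace PlanarBody

/-- The mutual distance of bodies `j` and `k`; the plane is identified with `ℂ`. -/
def mutualDist {n : ℕ} (q : Fin n → ℂ) (j k : Fin n) : ℝ := ‖q j - q k‖

/-- A configuration of point masses: no two bodies coincide and the centre of mass is at the
origin. -/
def IsConfiguration {n : ℕ} (m : Fin n → ℝ) (q : Fin n → ℂ) : Prop :=
  Function.Injective q ∧ ∑ k, (m k : ℂ) * q k = 0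

/-- The homogeneous potential function `U` of degree `-a`; each pair of bodies is counted once. -/
def potential {n : ℕ} (m : Fin n → ℝ) (a : ℝ) (q : Fin n → ℂ) : ℝ :=
  (1 / a) * ∑ k, ∑ j, if j < k then m j * m k / mutualDist q j k ^ a else 0

/-- The force `g_k(q)` acting on body `k`. -/
def force {n : ℕ} (m : Fin n → ℝ) (a : ℝ) (q : Fin n → ℂ) (k : Fin n) : ℂ :=
  ∑ j ∈ Finset.univ.erase k, ((m j * m k / mutualDist q j k ^ (a + 2) : ℝ) : ℂ) * (q j - q k)

/-- The moment of inertia `I`. -/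
def inertia {n : ℕ} (m : Fin n → ℝ) (q : Fin n → ℂ) : ℝ := ∑ k, m k * ‖q k‖ ^ 2

/-- The kinetic energy `T`. -/
def kinetic {n : ℕ} (m : Fin n → ℝ) (p : Fin n → ℂ) : ℝ := (1 / 2) * ∑ k, ‖p k‖ ^ 2 / m k

/-- The total energy `H = T - U`. -/
def energy {n : ℕ} (m : Fin n → ℝ) (a : ℝ) (q p : Fin n → ℂ) : ℝ :=
  kinetic m p - potential m a q

/-- The angular momentum `C = ∑ q_k ∧ p_k`, where `z ∧ w = Im (z̄ w)`. -/
def angularMomentum {n : ℕ} (q p : Fin n → ℂ) : ℝ :=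
  ∑ k, (starRingEnd ℂ (q k) * p k).im

/-- The configurational measure `U I^{a/2}`. -/
def configMeasure {n : ℕ} (m : Fin n → ℝ) (a : ℝ) (q : Fin n → ℂ) : ℝ :=
  potential m a q * inertia m q ^ (a / 2)

/-- `(q, p)` is a (collision-free) solution of the equations of motion on the set `J` of times,
in the frame whose origin is the centre of mass. -/
structure IsSolution {n : ℕ} (m : Fin n → ℝ) (a : ℝ) (J : Set ℝ) (q p : ℝ → Fin n → ℂ) :
    Prop where
  configuration : ∀ t ∈ J, IsConfiguration m (q t)
  position : ∀ t ∈ J, ∀ k, HasDerivAt (fun s => q s k) (p t k / (m k : ℂ)) t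
  momentum : ∀ t ∈ J, ∀ k, HasDerivAt (fun s => p s k) (force m a (q t) k) t

/-- The effective potential `Φ(x) = -4 H x - 4 μ x^{(2-a)/2}` of the moment of inertia. -/
def effectivePotential (a H μ x : ℝ) : ℝ := -4 * H * x - 4 * μ * x ^ ((2 - a) / 2)

/-- The number `B` given at time `t` by `(1/2) (dI/dt)² + Φ(I) = -2B`, along the motion `(q, p)`.
It does not depend on `t` when `(q, p)` is a solution of constant configurational measure. -/
def integralB {n : ℕ} (m : Fin n → ℝ) (a : ℝ) (q p : ℝ → Fin n → ℂ) (t : ℝ) : ℝ :=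
  -(1 / 2) * ((1 / 2) * (deriv (fun s => inertia m (q s)) t) ^ 2 +
    effectivePotential a (energy m a (q t) (p t)) (configMeasure m a (q t)) (inertia m (q t)))

/-- `G_k(Q) = g_k(Q) + a μ m_k Q_k`. -/
def shapeForce {n : ℕ} (m : Fin n → ℝ) (a : ℝ) (Q : Fin n → ℂ) (k : Fin n) : ℂ :=
  force m a Q k + ((a * configMeasure m a Q * m k : ℝ) : ℂ) * Q k

/-- The configuration rescaled to unit moment of inertia. -/
def normalize {n : ℕ} (m : Fin n → ℝ) (q : Fin n → ℂ) (k : Fin n) : ℂ :=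
  q k / ((Real.sqrt (inertia m q) : ℝ) : ℂ)

/-- Central configurations: all `G_k` vanish at the normalized configuration. (A rotation of the
configuration multiplies every `G_k` by the same phase, so it plays no role here.) -/
def IsCentral {n : ℕ} (m : Fin n → ℝ) (a : ℝ) (q : Fin n → ℂ) : Prop :=
  ∀ k, shapeForce m a (normalize m q) k = 0

end PlanarBody

end

noncomputable section

namespace PlanarBody

open ComplexConjugate

/-! ### Jacobi coordinates of the three-body problem -/

/-! Let `z` and `ρ` be the Jacobi vectors, `ζ = ρ / z` the shape and `I = |z|² R(ζ)`. By Lagrange's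
identity `B - C²` is a fixed multiple of `|zρ' - ρz'|²`, the squared speed of the shape for the
metric `|dζ| / R` and the time `∫ dt / I` (`integralB_sub`). Constancy of `μ` confines `ζ` to a
level curve of `μ`, while the force on the shape is normal to that curve. The speed is therefore a
constant `τ`, and the normal component of the equations of motion becomes `I ^ ((2 - a) / 2) φ + τ²
k = -2τC`, where `φ` is the `slope` of `μ` and `k` is the geodesic curvature of the level curve
(`reduced_motion`). Since `q⁰` is not central, `φ > 0` there.

If `a ≠ 2`, two differentiations of this relation express `İ` and `Ï` at `q⁰` through `τ`; they are
`O(τ)` and `O(τ²)`. The relation itself forces `C²` to grow like `1 / τ²`. But `Ï = 4T - 2aU ≥ 2C² /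
I - 2aU` by Sundman's inequality, which is impossible for small `τ` (`exists_speed_bound`).

If `a = 2`, the power of `I` disappears, and differentiation along the level curve gives `φ' + τ² k'
= 0`. Two motions through `q⁰` with different `τ²` would give `k' = 0`, so the level curve would be
an arc of a circle on the shape sphere. On such an arc the squared distances divided by `I` are
harmonic oscillations of one frequency (`isOscillation_of_circle`), and `2μ` is a sum of positive
multiples of their reciprocals. Such a sum is constant only if every oscillation is constant
(`const_of_sum_div`), and then the shape would not move along its own level curve. Hence `B - C²`
has at most one positive value at `q⁰`. -/

/-- The relative weight of body `0` in the pair `0, 1`. -/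
def weight₀ (m : Fin 3 → ℝ) : ℝ := m 0 / (m 0 + m 1)

/-- The relative weight of body `1` in the pair `0, 1`. -/
def weight₁ (m : Fin 3 → ℝ) : ℝ := m 1 / (m 0 + m 1)

/-- The reduced mass of the pair `0, 1`. -/
def innerMass (m : Fin 3 → ℝ) : ℝ := m 0 * m 1 / (m 0 + m 1)

/-- The reduced mass of body `2` with respect to the pair `0, 1`. -/
def outerMass (m : Fin 3 → ℝ) : ℝ := m 2 * (m 0 + m 1) / (m 0 + m 1 + m 2)

/-- The position of body `1` relative to body `0`. -/
def innerVec (q : Fin 3 → ℂ) : ℂ := q 1 - q 0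

/-- The position of body `2` relative to the centre of mass of the bodies `0`, `1`. -/
def outerVec (m : Fin 3 → ℝ) (q : Fin 3 → ℂ) : ℂ :=
  q 2 - ((weight₀ m : ℂ) * q 0 + (weight₁ m : ℂ) * q 1)

/-- The velocities belonging to the momenta `p`. -/
def velocity (m : Fin 3 → ℝ) (p : Fin 3 → ℂ) (k : Fin 3) : ℂ := p k / (m k : ℂ)

/-- The coefficient of the force between `j` and `k`. -/
def pairForce (m : Fin 3 → ℝ) (a : ℝ) (q : Fin 3 → ℂ) (j k : Fin 3) : ℝ :=
  m j * m k / mutualDist q j k ^ (a + 2)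

variable {m : Fin 3 → ℝ} {a : ℝ} {q p : Fin 3 → ℂ}

lemma pairForce_comm (m : Fin 3 → ℝ) (a : ℝ) (q : Fin 3 → ℂ) (j k : Fin 3) :
    pairForce m a q j k = pairForce m a q k j := by
  simp only [pairForce, mutualDist, mul_comm (m j), norm_sub_rev (q j)]

lemma force_zero (m : Fin 3 → ℝ) (a : ℝ) (q : Fin 3 → ℂ) :
    force m a q 0 = pairForce m a q 0 1 * (q 1 - q 0) + pairForce m a q 0 2 * (q 2 - q 0) := by
  rw [force, show Finset.univ.erase (0 : Fin 3) = {1, 2} by decide,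
    Finset.sum_pair (by decide), pairForce_comm m a q 0 1, pairForce_comm m a q 0 2]
  rfl

lemma force_one (m : Fin 3 → ℝ) (a : ℝ) (q : Fin 3 → ℂ) :
    force m a q 1 = pairForce m a q 0 1 * (q 0 - q 1) + pairForce m a q 1 2 * (q 2 - q 1) := by
  rw [force, show Finset.univ.erase (1 : Fin 3) = {0, 2} by decide,
    Finset.sum_pair (by decide), pairForce_comm m a q 1 2]
  rfl

lemma force_two (m : Fin 3 → ℝ) (a : ℝ) (q : Fin 3 → ℂ) :
    force m a q 2 = pairForce m a q 0 2 * (q 0 - q 2) + pairForce m a q 1 2 * (q 1 - q 2) := by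
  rw [force, show Finset.univ.erase (2 : Fin 3) = {0, 1} by decide,
    Finset.sum_pair (by decide)]
  rfl

lemma mutualDist_pos (hq : Function.Injective q) {j k : Fin 3} (h : j ≠ k) :
    0 < mutualDist q j k :=
  norm_pos_iff.2 (sub_ne_zero.2 (hq.ne h))

lemma potential_eq (m : Fin 3 → ℝ) (a : ℝ) (q : Fin 3 → ℂ) :
    potential m a q = 1 / a * (m 0 * m 1 / mutualDist q 0 1 ^ a + m 0 * m 2 / mutualDist q 0 2 ^ a
      + m 1 * m 2 / mutualDist q 1 2 ^ a) := by
  simp [potential, Fin.sum_univ_three]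
  left; ring

lemma mul_potential (ha : 0 < a) (hq : Function.Injective q) :
    a * potential m a q = pairForce m a q 0 1 * mutualDist q 0 1 ^ 2
      + pairForce m a q 0 2 * mutualDist q 0 2 ^ 2 + pairForce m a q 1 2 * mutualDist q 1 2 ^ 2 := by
  have key : ∀ j k : Fin 3, j ≠ k →
      pairForce m a q j k * mutualDist q j k ^ 2 = m j * m k / mutualDist q j k ^ a := by
    intro j k h
    have := mutualDist_pos hq h
    rw [pairForce, Real.rpow_add this, Real.rpow_two]
    field_simp
  rw [key _ _ (by decide), key _ _ (by decide), key _ _ (by decide), potential_eq]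
  field_simp

/-- Euler's identity for the homogeneous potential, in complex form. Each pair force acts along the
line of its two bodies, so the sum is real: its imaginary part gives conservation of `C` and its
real part the Lagrange–Jacobi formula. -/
lemma sum_conj_mul_force (ha : 0 < a) (hq : Function.Injective q) :
    ∑ k, conj (q k) * force m a q k = -(a * potential m a q : ℝ) := by
  rw [mul_potential ha hq, Fin.sum_univ_three, force_zero, force_one, force_two]
  simp only [mutualDist]
  push_cast
  simp only [← Complex.mul_conj', map_sub]
  ring

lemma sum_momentum (hm : ∀ k, 0 < m k) (p : Fin 3 → ℂ) :
    ∑ k, (m k : ℂ) * velocity m p k = ∑ k, p k := by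
  refine Finset.sum_congr rfl fun k _ => ?_
  have : (m k : ℂ) ≠ 0 := by exact_mod_cast (hm k).ne'
  rw [velocity]; field_simp

/-- The Hermitian product of the mass metric in Jacobi coordinates. -/
lemma hermitian_eq (hm : ∀ k, 0 < m k) {x y : Fin 3 → ℂ}
    (hx : ∑ k, (m k : ℂ) * x k = 0) (hy : ∑ k, (m k : ℂ) * y k = 0) :
    ∑ k, (m k : ℂ) * (conj (x k) * y k) = innerMass m * (conj (innerVec x) * innerVec y)
      + outerMass m * (conj (outerVec m x) * outerVec m y) := by
  have h0 : (m 0 : ℂ) ≠ 0 := by exact_mod_cast (hm 0).ne'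
  have h1 : (m 1 : ℂ) ≠ 0 := by exact_mod_cast (hm 1).ne'
  have h2 : (m 2 : ℂ) ≠ 0 := by exact_mod_cast (hm 2).ne'
  have h01 : (m 0 + m 1 : ℂ) ≠ 0 := by exact_mod_cast (add_pos (hm 0) (hm 1)).ne'
  have h012 : (m 0 + m 1 + m 2 : ℂ) ≠ 0 := by
    exact_mod_cast (add_pos (add_pos (hm 0) (hm 1)) (hm 2)).ne'
  have key : ∀ x : Fin 3 → ℂ, ∑ k, (m k : ℂ) * x k = 0 →
      x 2 = -(m 0 * x 0 + m 1 * x 1) / m 2 := by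
    intro x hx
    rw [Fin.sum_univ_three] at hx
    rw [eq_div_iff h2]; linear_combination hx
  have hx' := key x hx
  have hy' := key y hy
  simp only [Fin.sum_univ_three, innerVec, outerVec, weight₀, weight₁, innerMass, outerMass]
  rw [hx', hy']
  simp only [map_sub, map_add, map_mul, map_div₀, map_neg, Complex.conj_ofReal]
  push_cast
  field_simp
  ring

lemma inertia_eq (hm : ∀ k, 0 < m k) (hq : ∑ k, (m k : ℂ) * q k = 0) :
    inertia m q = innerMass m * ‖innerVec q‖ ^ 2 + outerMass m * ‖outerVec m q‖ ^ 2 := by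
  have := hermitian_eq hm hq hq
  simp only [Complex.conj_mul'] at this
  rw [inertia]
  exact_mod_cast this

lemma conj_mul_momentum (hm : ∀ k, 0 < m k) (q p : Fin 3 → ℂ) (k : Fin 3) :
    conj (q k) * p k = (m k : ℂ) * (conj (q k) * velocity m p k) := by
  have : (m k : ℂ) ≠ 0 := by exact_mod_cast (hm k).ne'
  rw [velocity]; field_simp

lemma sum_conj_mul_momentum (hm : ∀ k, 0 < m k) (hq : ∑ k, (m k : ℂ) * q k = 0)
    (hp : ∑ k, p k = 0) :
    ∑ k, conj (q k) * p k =
      innerMass m * (conj (innerVec q) * innerVec (velocity m p))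
        + outerMass m * (conj (outerVec m q) * outerVec m (velocity m p)) := by
  rw [← hermitian_eq hm hq ((sum_momentum hm p).trans hp)]
  exact Finset.sum_congr rfl fun k _ => conj_mul_momentum hm q p k

lemma angularMomentum_eq_im (q p : Fin 3 → ℂ) :
    angularMomentum q p = (∑ k, conj (q k) * p k).im := by
  rw [angularMomentum, Complex.im_sum]

lemma two_mul_kinetic (hm : ∀ k, 0 < m k) (hp : ∑ k, p k = 0) :
    2 * kinetic m p = innerMass m * ‖innerVec (velocity m p)‖ ^ 2
      + outerMass m * ‖outerVec m (velocity m p)‖ ^ 2 := by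
  rw [← inertia_eq hm ((sum_momentum hm p).trans hp), kinetic, inertia, ← mul_assoc]
  norm_num
  refine Finset.sum_congr rfl fun k _ => ?_
  have := hm k
  rw [velocity, norm_div, Complex.norm_real, Real.norm_of_nonneg this.le]
  field_simp

/-- Lagrange's identity. -/
lemma lagrange_identity (x y : ℝ) (z r u v : ℂ) :
    (x * ‖z‖ ^ 2 + y * ‖r‖ ^ 2) * (x * ‖u‖ ^ 2 + y * ‖v‖ ^ 2)
      - ‖(x : ℂ) * (conj z * u) + y * (conj r * v)‖ ^ 2 = x * y * ‖z * v - r * u‖ ^ 2 := by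
  simp only [Complex.sq_norm, Complex.normSq_apply, Complex.add_re, Complex.add_im,
    Complex.sub_re, Complex.sub_im, Complex.mul_re, Complex.mul_im, Complex.conj_re,
    Complex.conj_im, Complex.ofReal_re, Complex.ofReal_im]
  ring

lemma inertia_pos (hm : ∀ k, 0 < m k) (hq : Function.Injective q) : 0 < inertia m q := by
  have h0 : ∃ k, q k ≠ 0 := by
    by_contra! h
    exact absurd (hq ((h 0).trans (h 1).symm)) (by decide)
  obtain ⟨k, hk⟩ := h0
  refine Finset.sum_pos' (fun i _ => mul_nonneg (hm i).le (by positivity)) ⟨k, Finset.mem_univ _, ?_⟩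
  have := hm k
  have := norm_pos_iff.2 hk
  positivity

lemma weight_add (hm : ∀ k, 0 < m k) : weight₀ m + weight₁ m = 1 := by
  have := (add_pos (hm 0) (hm 1)).ne'
  rw [weight₀, weight₁]; field_simp

lemma innerMass_pos (hm : ∀ k, 0 < m k) : 0 < innerMass m := by
  have := hm 0; have := hm 1
  rw [innerMass]; positivity

lemma outerMass_pos (hm : ∀ k, 0 < m k) : 0 < outerMass m := by
  have := hm 0; have := hm 1; have := hm 2
  rw [outerMass]; positivity

/-- The accelerations. -/
def acceleration (m : Fin 3 → ℝ) (a : ℝ) (q : Fin 3 → ℂ) : Fin 3 → ℂ := velocity m (force m a q)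

lemma sub_outer (hm : ∀ k, 0 < m k) (q : Fin 3 → ℂ) :
    q 2 - q 0 = outerVec m q + weight₁ m * innerVec q ∧
      q 2 - q 1 = outerVec m q - weight₀ m * innerVec q := by
  have h : (weight₀ m : ℂ) = 1 - weight₁ m := by
    rw [eq_sub_iff_add_eq]; exact_mod_cast weight_add hm
  constructor <;> simp only [outerVec, innerVec, h] <;> ring

/-- The wedge of the Jacobi vectors with their accelerations kills every complex multiple of `q`,
that is, scaling and rotation. What remains is the force on the shape. -/
lemma wedge_acceleration (hm : ∀ k, 0 < m k) (a : ℝ) (q : Fin 3 → ℂ) :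
    (innerMass m * outerMass m : ℂ) * (innerVec q * outerVec m (acceleration m a q)
      - outerVec m q * innerVec (acceleration m a q)) =
    pairForce m a q 0 1 * outerMass m * (innerVec q * outerVec m q)
      + pairForce m a q 0 2 * (outerVec m q + weight₁ m * innerVec q)
        * (outerMass m * weight₁ m * outerVec m q - innerMass m * innerVec q)
      - pairForce m a q 1 2 * (outerVec m q - weight₀ m * innerVec q)
        * (outerMass m * weight₀ m * outerVec m q + innerMass m * innerVec q) := by
  obtain ⟨e0, e1⟩ := sub_outer hm q
  have h0 : (m 0 : ℂ) ≠ 0 := by exact_mod_cast (hm 0).ne'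
  have h1 : (m 1 : ℂ) ≠ 0 := by exact_mod_cast (hm 1).ne'
  have h2 : (m 2 : ℂ) ≠ 0 := by exact_mod_cast (hm 2).ne'
  have h01 : (m 0 + m 1 : ℂ) ≠ 0 := by exact_mod_cast (add_pos (hm 0) (hm 1)).ne'
  have h012 : (m 0 + m 1 + m 2 : ℂ) ≠ 0 := by
    exact_mod_cast (add_pos (add_pos (hm 0) (hm 1)) (hm 2)).ne'
  have f0 : q 0 - q 2 = -(outerVec m q + weight₁ m * innerVec q) := by rw [← e0]; ring
  have f1 : q 1 - q 2 = -(outerVec m q - weight₀ m * innerVec q) := by rw [← e1]; ring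
  have f2 : q 0 - q 1 = - innerVec q := by rw [innerVec]; ring
  have f3 : q 1 - q 0 = innerVec q := rfl
  generalize hr : outerVec m q = r at *
  generalize hz : innerVec q = z at *
  simp only [innerVec, outerVec, acceleration, velocity, force_zero, force_one, force_two]
  rw [e0, e1, f0, f1, f2, f3]
  simp only [weight₀, weight₁, innerMass, outerMass]
  push_cast
  field_simp
  ring

end PlanarBody
end

noncomputable section

namespace PlanarBody

open ComplexConjugate Filter Topology

variable {m : Fin 3 → ℝ} {a : ℝ} {J : Set ℝ} {q p : ℝ → Fin 3 → ℂ} {t : ℝ}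

/-! ### Conservation laws and virial identities -/

/-- The vanishing of the total momentum is not part of the definition of a solution. It comes from
differentiating the centre-of-mass constraint, which holds on an open set of times. -/
lemma IsSolution.sum_momentum_eq_zero (h : IsSolution m a J q p) (hm : ∀ k, 0 < m k)
    (hJ : IsOpen J) (ht : t ∈ J) : ∑ k, p t k = 0 := by
  have h1 : HasDerivAt (fun s => ∑ k, (m k : ℂ) * q s k) (∑ k, (m k : ℂ) * velocity m (p t) k) t :=
    HasDerivAt.fun_sum fun k _ => (h.position t ht k).const_mul _
  have h2 : (fun s => ∑ k, (m k : ℂ) * q s k) =ᶠ[𝓝 t] fun _ => 0 := by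
    filter_upwards [hJ.mem_nhds ht] with s hs using (h.configuration s hs).2
  rw [← sum_momentum hm]
  exact h1.unique ((hasDerivAt_const t (0 : ℂ)).congr_of_eventuallyEq h2)

lemma hasDerivAt_innerVec {x : ℝ → Fin 3 → ℂ} {x' : Fin 3 → ℂ}
    (hx : ∀ k, HasDerivAt (fun s => x s k) (x' k) t) :
    HasDerivAt (fun s => innerVec (x s)) (innerVec x') t :=
  (hx 1).sub (hx 0)

lemma hasDerivAt_outerVec {x : ℝ → Fin 3 → ℂ} {x' : Fin 3 → ℂ}
    (hx : ∀ k, HasDerivAt (fun s => x s k) (x' k) t) :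
    HasDerivAt (fun s => outerVec m (x s)) (outerVec m x') t :=
  (hx 2).sub (((hx 0).const_mul _).add ((hx 1).const_mul _))

lemma IsSolution.hasDerivAt_velocity (h : IsSolution m a J q p) (ht : t ∈ J) (k : Fin 3) :
    HasDerivAt (fun s => velocity m (p s) k) (acceleration m a (q t) k) t :=
  (h.momentum t ht k).div_const _

lemma hasDerivAt_conj {f : ℝ → ℂ} {f' : ℂ} (hf : HasDerivAt f f' t) :
    HasDerivAt (fun s => conj (f s)) (conj f') t :=
  Complex.conjCLE.toContinuousLinearMap.hasFDerivAt.comp_hasDerivAt t hf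

lemma hasDerivAt_re {f : ℝ → ℂ} {f' : ℂ} (hf : HasDerivAt f f' t) :
    HasDerivAt (fun s => (f s).re) f'.re t :=
  Complex.reCLM.hasFDerivAt.comp_hasDerivAt t hf

lemma hasDerivAt_im {f : ℝ → ℂ} {f' : ℂ} (hf : HasDerivAt f f' t) :
    HasDerivAt (fun s => (f s).im) f'.im t :=
  Complex.imCLM.hasFDerivAt.comp_hasDerivAt t hf

lemma kinetic_eq (m : Fin 3 → ℝ) (hm : ∀ k, 0 < m k) (p : Fin 3 → ℂ) :
    ∑ k, conj (velocity m p k) * p k = (2 * kinetic m p : ℝ) := by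
  rw [kinetic, ← mul_assoc]
  norm_num
  refine Finset.sum_congr rfl fun k _ => ?_
  have : (m k : ℂ) ≠ 0 := by exact_mod_cast (hm k).ne'
  rw [velocity, ← Complex.conj_mul', map_div₀, Complex.conj_ofReal]
  field_simp

/-- The derivative of `∑ q̄_k p_k`, whose real and imaginary parts are `İ / 2` and `C`. -/
lemma IsSolution.hasDerivAt_sum_conj_mul (h : IsSolution m a J q p) (hm : ∀ k, 0 < m k)
    (ha : 0 < a) (ht : t ∈ J) :
    HasDerivAt (fun s => ∑ k, conj (q s k) * p s k)
      ((2 * kinetic m (p t) - a * potential m a (q t) : ℝ) : ℂ) t := by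
  have h1 : HasDerivAt (fun s => ∑ k, conj (q s k) * p s k)
      (∑ k, (conj (velocity m (p t) k) * p t k + conj (q t k) * force m a (q t) k)) t :=
    HasDerivAt.fun_sum fun k _ =>
      (hasDerivAt_conj (h.position t ht k)).mul (h.momentum t ht k)
  convert h1 using 1
  rw [Finset.sum_add_distrib, kinetic_eq m hm, sum_conj_mul_force ha (h.configuration t ht).1]
  push_cast; ring

lemma IsSolution.hasDerivAt_inertia (h : IsSolution m a J q p) (hm : ∀ k, 0 < m k) (ht : t ∈ J) :
    HasDerivAt (fun s => inertia m (q s)) (2 * (∑ k, conj (q t k) * p t k).re) t := by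
  have h1 : HasDerivAt (fun s => ∑ k, (m k : ℂ) * (conj (q s k) * q s k))
      (∑ k, (m k : ℂ) * (conj (velocity m (p t) k) * q t k + conj (q t k) * velocity m (p t) k)) t :=
    HasDerivAt.fun_sum fun k _ =>
      ((hasDerivAt_conj (h.position t ht k)).mul (h.position t ht k)).const_mul _
  have h2 := hasDerivAt_re h1
  have e1 : (fun s => inertia m (q s)) =
      fun s => (∑ k, (m k : ℂ) * (conj (q s k) * q s k)).re := by
    funext s
    simp only [Complex.conj_mul', inertia]
    norm_cast
  rw [e1]
  convert h2 using 1
  rw [Complex.re_sum, Complex.re_sum, Finset.mul_sum]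
  refine Finset.sum_congr rfl fun k _ => ?_
  rw [conj_mul_momentum hm]
  simp [Complex.mul_re, Complex.mul_im]
  ring

lemma IsSolution.hasDerivAt_angularMomentum (h : IsSolution m a J q p) (hm : ∀ k, 0 < m k)
    (ha : 0 < a) (ht : t ∈ J) : HasDerivAt (fun s => angularMomentum (q s) (p s)) 0 t := by
  simp only [angularMomentum_eq_im]
  exact (hasDerivAt_im (h.hasDerivAt_sum_conj_mul hm ha ht)).congr_deriv (Complex.ofReal_im _)

lemma IsSolution.hasDerivAt_deriv_inertia (h : IsSolution m a J q p) (hm : ∀ k, 0 < m k)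
    (ha : 0 < a) (ht : t ∈ J) :
    HasDerivAt (fun s => 2 * (∑ k, conj (q s k) * p s k).re)
      (4 * kinetic m (p t) - 2 * a * potential m a (q t)) t := by
  refine ((hasDerivAt_re (h.hasDerivAt_sum_conj_mul hm ha ht)).const_mul 2).congr_deriv ?_
  rw [Complex.ofReal_re]; ring

/-- Lagrange's identity splits `2IT` into dilation, rotation and change of shape, because the real
and imaginary parts of the Hermitian product of position and velocity are `İ / 2` and `C`. -/
lemma two_mul_inertia_mul_kinetic (hm : ∀ k, 0 < m k) {q p : Fin 3 → ℂ}
    (hq : ∑ k, (m k : ℂ) * q k = 0) (hp : ∑ k, p k = 0) :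
    2 * inertia m q * kinetic m p = (∑ k, conj (q k) * p k).re ^ 2 + angularMomentum q p ^ 2 +
      innerMass m * outerMass m * ‖innerVec q * outerVec m (velocity m p)
        - outerVec m q * innerVec (velocity m p)‖ ^ 2 := by
  have e := lagrange_identity (innerMass m) (outerMass m) (innerVec q) (outerVec m q)
    (innerVec (velocity m p)) (outerVec m (velocity m p))
  rw [← inertia_eq hm hq, ← two_mul_kinetic hm hp, ← sum_conj_mul_momentum hm hq hp,
    Complex.sq_norm, Complex.normSq_apply] at e
  rw [angularMomentum_eq_im]
  linarith

/-- Sundman's inequality: the dilation and shape terms are dropped. -/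
lemma sq_angularMomentum_le (hm : ∀ k, 0 < m k) {q p : Fin 3 → ℂ}
    (hq : ∑ k, (m k : ℂ) * q k = 0) (hp : ∑ k, p k = 0) :
    angularMomentum q p ^ 2 ≤ 2 * inertia m q * kinetic m p := by
  rw [two_mul_inertia_mul_kinetic hm hq hp]
  have := innerMass_pos hm
  have := outerMass_pos hm
  have := sq_nonneg (∑ k, conj (q k) * p k).re
  have : 0 ≤ innerMass m * outerMass m * ‖innerVec q * outerVec m (velocity m p)
        - outerVec m q * innerVec (velocity m p)‖ ^ 2 := by positivity
  linarith

/-- `B - C²` is the squared speed of the shape. -/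
lemma IsSolution.integralB_sub (h : IsSolution m a J q p) (hm : ∀ k, 0 < m k)
    (hJ : IsOpen J) (ht : t ∈ J) :
    integralB m a q p t - angularMomentum (q t) (p t) ^ 2 =
      innerMass m * outerMass m * ‖innerVec (q t) * outerVec m (velocity m (p t))
        - outerVec m (q t) * innerVec (velocity m (p t))‖ ^ 2 := by
  have hI := inertia_pos hm (h.configuration t ht).1
  have e := two_mul_inertia_mul_kinetic hm (h.configuration t ht).2
    (h.sum_momentum_eq_zero hm hJ ht)
  rw [integralB, (h.hasDerivAt_inertia hm ht).deriv, effectivePotential, configMeasure, energy]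
  -- Hence `μ I ^ ((2 - a) / 2) = U I`, so `U` cancels and `B = 2IT - (İ / 2)²`.
  have : inertia m (q t) ^ (a / 2) * inertia m (q t) ^ ((2 - a) / 2) = inertia m (q t) := by
    rw [← Real.rpow_add hI]
    convert Real.rpow_one _ using 2; ring
  linear_combination e + 2 * potential m a (q t) * this

/-! ### The shape of a configuration -/

/-- The shape of a configuration: the ratio of its Jacobi vectors. -/
def shape (m : Fin 3 → ℝ) (q : Fin 3 → ℂ) : ℂ := outerVec m q / innerVec q

/-- The moment of inertia of the configuration of shape `ζ` with unit inner Jacobi vector. -/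
def shapeInertia (m : Fin 3 → ℝ) (ζ : ℂ) : ℝ := innerMass m + outerMass m * ‖ζ‖ ^ 2

/-- A positive multiple of the gradient of the configurational measure on the shape plane. -/
def shapeGrad (m : Fin 3 → ℝ) (a : ℝ) (ζ : ℂ) : ℂ :=
  ((m 0 * m 1 : ℝ) : ℂ) * (outerMass m * ζ)
    + ((m 0 * m 2 / ‖ζ + weight₁ m‖ ^ (a + 2) : ℝ) : ℂ)
      * ((ζ + weight₁ m) * (outerMass m * weight₁ m * ζ - innerMass m))
    - ((m 1 * m 2 / ‖ζ - weight₀ m‖ ^ (a + 2) : ℝ) : ℂ)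
      * ((ζ - weight₀ m) * (outerMass m * weight₀ m * ζ + innerMass m))

/-- The configurational measure as a function of the shape. -/
def shapeMeasure (m : Fin 3 → ℝ) (a : ℝ) (ζ : ℂ) : ℝ :=
  1 / a * (m 0 * m 1 + m 0 * m 2 / ‖ζ + weight₁ m‖ ^ a + m 1 * m 2 / ‖ζ - weight₀ m‖ ^ a)
    * shapeInertia m ζ ^ (a / 2)

section

variable {q : Fin 3 → ℂ}

lemma innerVec_ne_zero (hq : Function.Injective q) : innerVec q ≠ 0 :=
  sub_ne_zero.2 (hq.ne (by decide))

lemma outerVec_eq (hq : Function.Injective q) : outerVec m q = innerVec q * shape m q := by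
  rw [shape, mul_div_cancel₀ _ (innerVec_ne_zero hq)]

lemma shapeInertia_pos (hm : ∀ k, 0 < m k) (ζ : ℂ) : 0 < shapeInertia m ζ := by
  have := innerMass_pos hm
  have := outerMass_pos hm
  rw [shapeInertia]; positivity

lemma inertia_eq_shape (hm : ∀ k, 0 < m k) (hq : IsConfiguration m q) :
    inertia m q = ‖innerVec q‖ ^ 2 * shapeInertia m (shape m q) := by
  rw [inertia_eq hm hq.2, outerVec_eq hq.1, norm_mul, shapeInertia]; ring

lemma mutualDist_shape (hm : ∀ k, 0 < m k) (hq : Function.Injective q) :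
    mutualDist q 0 1 = ‖innerVec q‖ ∧
    mutualDist q 0 2 = ‖innerVec q‖ * ‖shape m q + weight₁ m‖ ∧
    mutualDist q 1 2 = ‖innerVec q‖ * ‖shape m q - weight₀ m‖ := by
  obtain ⟨e0, e1⟩ := sub_outer hm q
  rw [outerVec_eq hq] at e0 e1
  refine ⟨norm_sub_rev _ _, ?_, ?_⟩
  · rw [mutualDist, norm_sub_rev, e0, ← norm_mul]; ring_nf
  · rw [mutualDist, norm_sub_rev, e1, ← norm_mul]; ring_nf

lemma shape_ne (hm : ∀ k, 0 < m k) (hq : Function.Injective q) :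
    shape m q + weight₁ m ≠ 0 ∧ shape m q - weight₀ m ≠ 0 := by
  obtain ⟨-, e1, e2⟩ := mutualDist_shape hm hq
  have h1 := mutualDist_pos hq (show (0 : Fin 3) ≠ 2 by decide)
  have h2 := mutualDist_pos hq (show (1 : Fin 3) ≠ 2 by decide)
  constructor <;> intro h
  · rw [e1, h, norm_zero, mul_zero] at h1; exact lt_irrefl _ h1
  · rw [e2, h, norm_zero, mul_zero] at h2; exact lt_irrefl _ h2

lemma configMeasure_eq_shape (hm : ∀ k, 0 < m k) (hq : IsConfiguration m q) :
    configMeasure m a q = shapeMeasure m a (shape m q) := by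
  obtain ⟨e0, e1, e2⟩ := mutualDist_shape hm hq.1
  have hz : 0 < ‖innerVec q‖ := norm_pos_iff.2 (innerVec_ne_zero hq.1)
  have hR := shapeInertia_pos hm (shape m q)
  rw [configMeasure, potential_eq, inertia_eq_shape hm hq, e0, e1, e2, shapeMeasure,
    Real.mul_rpow hz.le (norm_nonneg _), Real.mul_rpow hz.le (norm_nonneg _),
    Real.mul_rpow (by positivity) hR.le, ← Real.rpow_natCast ‖innerVec q‖ 2, ← Real.rpow_mul hz.le]
  have : ((2 : ℕ) : ℝ) * (a / 2) = a := by push_cast; ring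
  rw [this]
  have : 0 < ‖innerVec q‖ ^ a := by positivity
  field_simp

lemma wedge_acceleration_shape (hm : ∀ k, 0 < m k) (hq : Function.Injective q) :
    (innerMass m * outerMass m : ℂ) * (innerVec q * outerVec m (acceleration m a q)
      - outerVec m q * innerVec (acceleration m a q)) =
    (((‖innerVec q‖ ^ (a + 2))⁻¹ : ℝ) : ℂ) * innerVec q ^ 2 * shapeGrad m a (shape m q) := by
  obtain ⟨e0, e1, e2⟩ := mutualDist_shape hm hq
  have hz : 0 < ‖innerVec q‖ := norm_pos_iff.2 (innerVec_ne_zero hq)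
  rw [wedge_acceleration hm, pairForce, pairForce, pairForce, e0, e1, e2, outerVec_eq hq,
    Real.mul_rpow hz.le (norm_nonneg _), Real.mul_rpow hz.le (norm_nonneg _), shapeGrad]
  push_cast
  ring

lemma sum_force (m : Fin 3 → ℝ) (a : ℝ) (q : Fin 3 → ℂ) : ∑ k, force m a q k = 0 := by
  rw [Fin.sum_univ_three, force_zero, force_one, force_two]; ring

lemma eq_zero_of_jacobi_eq_zero (hm : ∀ k, 0 < m k) {x : Fin 3 → ℂ}
    (hx : ∑ k, (m k : ℂ) * x k = 0) (h1 : innerVec x = 0) (h2 : outerVec m x = 0) (k : Fin 3) :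
    x k = 0 := by
  have e1 : x 1 = x 0 := sub_eq_zero.1 h1
  have e2 : x 2 = x 0 := by
    rw [outerVec, e1, ← add_mul, ← Complex.ofReal_add, weight_add hm] at h2
    simpa [sub_eq_zero] using h2
  have h012 : (m 0 + m 1 + m 2 : ℂ) ≠ 0 := by
    exact_mod_cast (add_pos (add_pos (hm 0) (hm 1)) (hm 2)).ne'
  have e0 : x 0 = 0 := by
    rw [Fin.sum_univ_three, e1, e2, ← add_mul, ← add_mul] at hx
    exact (mul_eq_zero.1 hx).resolve_left h012
  fin_cases k
  · exact e0
  · exact e1.trans e0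
  · exact e2.trans e0

/-- A vanishing wedge makes the accelerations one common complex multiple `c` of the positions.
Pairing with `q` and using Euler's identity gives `c I = -aU`, so `c` is real. -/
lemma force_eq_of_shapeGrad_eq_zero (hm : ∀ k, 0 < m k) (ha : 0 < a) (hq : IsConfiguration m q)
    (h0 : shapeGrad m a (shape m q) = 0) (k : Fin 3) :
    force m a q k = -((a * potential m a q / inertia m q * m k : ℝ) : ℂ) * q k := by
  have hz := innerVec_ne_zero hq.1
  have hI : (inertia m q : ℂ) ≠ 0 := by exact_mod_cast (inertia_pos hm hq.1).ne'
  have hM : (innerMass m * outerMass m : ℂ) ≠ 0 := by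
    exact_mod_cast (mul_pos (innerMass_pos hm) (outerMass_pos hm)).ne'
  have hw := wedge_acceleration_shape (a := a) hm hq.1
  rw [h0, mul_zero, mul_eq_zero, or_iff_right hM, sub_eq_zero] at hw
  set c := innerVec (acceleration m a q) / innerVec q with hc
  have h1 : innerVec (acceleration m a q) = c * innerVec q := by rw [hc]; field_simp
  have h2 : outerVec m (acceleration m a q) = c * outerVec m q := by
    rw [hc]; field_simp; linear_combination hw
  have hx : ∑ k, (m k : ℂ) * (acceleration m a q k - c * q k) = 0 := by
    have e1 : ∑ k, (m k : ℂ) * acceleration m a q k = 0 :=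
      (sum_momentum hm _).trans (sum_force m a q)
    have e2 := hq.2
    rw [Fin.sum_univ_three] at *
    linear_combination e1 - c * e2
  have hacc : ∀ k, force m a q k = c * (m k * q k) := by
    intro k
    have h3 := eq_zero_of_jacobi_eq_zero hm hx
      (by simp only [innerVec] at h1 ⊢; linear_combination h1)
      (by simp only [outerVec] at h2 ⊢; linear_combination h2) k
    have hk : (m k : ℂ) ≠ 0 := by exact_mod_cast (hm k).ne'
    rw [sub_eq_zero, acceleration, velocity, div_eq_iff hk] at h3
    rw [h3]; ring
  have hs := sum_conj_mul_force (m := m) ha hq.1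
  have hI' : (inertia m q : ℂ) = ∑ k, conj (q k) * (m k * q k) := by
    rw [inertia]; push_cast
    refine Finset.sum_congr rfl fun k _ => ?_
    rw [← Complex.conj_mul']; ring
  have hcI : c * inertia m q = -(a * potential m a q : ℝ) := by
    rw [← hs, hI', Finset.mul_sum]
    refine Finset.sum_congr rfl fun k _ => ?_
    rw [hacc]; ring
  rw [← eq_div_iff hI] at hcI
  rw [hacc, hcI]; push_cast; ring

lemma inertia_normalize (hm : ∀ k, 0 < m k) (hq : Function.Injective q) :
    inertia m (normalize m q) = 1 := by
  have hI := inertia_pos hm hq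
  have : inertia m (normalize m q) = inertia m q / inertia m q := by
    nth_rw 2 [inertia]
    rw [inertia, Finset.sum_div]
    refine Finset.sum_congr rfl fun k _ => ?_
    rw [normalize, norm_div, Complex.norm_real, Real.norm_of_nonneg (Real.sqrt_nonneg _), div_pow,
      Real.sq_sqrt hI.le, mul_div_assoc]
  rw [this, div_self hI.ne']

lemma IsConfiguration.normalize (hm : ∀ k, 0 < m k) (hq : IsConfiguration m q) :
    IsConfiguration m (normalize m q) := by
  have hs : ((Real.sqrt (inertia m q) : ℝ) : ℂ) ≠ 0 := by
    exact_mod_cast (Real.sqrt_pos.2 (inertia_pos hm hq.1)).ne'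
  refine ⟨fun i j hij => hq.1 ((div_left_inj' hs).1 hij), ?_⟩
  have : ∀ k, (m k : ℂ) * PlanarBody.normalize m q k
      = (m k : ℂ) * q k / ((Real.sqrt (inertia m q) : ℝ) : ℂ) := fun k => by
    rw [PlanarBody.normalize, mul_div_assoc]
  simp only [this]
  rw [← Finset.sum_div, hq.2, zero_div]

lemma shape_normalize (hm : ∀ k, 0 < m k) (hq : Function.Injective q) :
    shape m (normalize m q) = shape m q := by
  have hs : ((Real.sqrt (inertia m q) : ℝ) : ℂ) ≠ 0 := by
    exact_mod_cast (Real.sqrt_pos.2 (inertia_pos hm hq)).ne'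
  have e1 : innerVec (normalize m q) = innerVec q / ((Real.sqrt (inertia m q) : ℝ) : ℂ) := by
    simp only [innerVec, normalize]; ring
  have e2 : outerVec m (normalize m q) = outerVec m q / ((Real.sqrt (inertia m q) : ℝ) : ℂ) := by
    simp only [outerVec, normalize]; ring
  rw [shape, e1, e2, div_div_div_cancel_right₀ hs, shape]

/-- The gradient on the shape plane vanishes only at central configurations. -/
lemma isCentral_of_shapeGrad_eq_zero (hm : ∀ k, 0 < m k) (ha : 0 < a) (hq : IsConfiguration m q)
    (h0 : shapeGrad m a (shape m q) = 0) : IsCentral m a q := by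
  intro k
  rw [← shape_normalize hm hq.1] at h0
  have hI := inertia_normalize hm hq.1
  rw [shapeForce, force_eq_of_shapeGrad_eq_zero hm ha (hq.normalize hm) h0, configMeasure, hI,
    Real.one_rpow]
  push_cast; ring

end

end PlanarBody
end

noncomputable section

namespace PlanarBody

open ComplexConjugate Filter Topology

open scoped ContDiff

variable {m : Fin 3 → ℝ} {a : ℝ}

/-! ### The level curves of the configurational measure on the shape plane -/

/-- The shapes without collisions at which the configurational measure is not critical. -/
def IsRegularShape (m : Fin 3 → ℝ) (a : ℝ) (ζ : ℂ) : Prop :=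
  ζ + weight₁ m ≠ 0 ∧ ζ - weight₀ m ≠ 0 ∧ shapeGrad m a ζ ≠ 0

/-- The unit normal of the level curves. -/
def unitGrad (m : Fin 3 → ℝ) (a : ℝ) (ζ : ℂ) : ℂ := shapeGrad m a ζ / ((‖shapeGrad m a ζ‖ : ℝ) : ℂ)

/-- The tangent field of the level curves, of unit length for the metric of the shape sphere. -/
def levelField (m : Fin 3 → ℝ) (a : ℝ) (ζ : ℂ) : ℂ :=
  (shapeInertia m ζ : ℂ) * (Complex.I * unitGrad m a ζ)

/-- The derivative of `h` along the level curves. -/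
def alongLevel {E : Type*} [NormedAddCommGroup E] [NormedSpace ℝ E]
    (m : Fin 3 → ℝ) (a : ℝ) (h : ℂ → E) (ζ : ℂ) : E :=
  fderiv ℝ h ζ (levelField m a ζ)

/-- The angular speed of the unit normal along the level curves. -/
def turning (m : Fin 3 → ℝ) (a : ℝ) (ζ : ℂ) : ℝ :=
  (conj (unitGrad m a ζ) * alongLevel m a (unitGrad m a) ζ).im

/-- The geodesic curvature of the level curves on the shape sphere. -/
def levelCurvature (m : Fin 3 → ℝ) (a : ℝ) (ζ : ℂ) : ℝ :=
  turning m a ζ - 2 * outerMass m * (conj ζ * unitGrad m a ζ).re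

/-- The length of the gradient on the shape sphere. -/
def slope (m : Fin 3 → ℝ) (a : ℝ) (ζ : ℂ) : ℝ :=
  shapeInertia m ζ ^ (a / 2) * (‖shapeGrad m a ζ‖ / (innerMass m * outerMass m))

variable {ζ : ℂ}

/-! ### Smoothness of the level-curve data at regular shapes. -/

lemma contDiff_shapeInertia (m : Fin 3 → ℝ) : ContDiff ℝ ∞ (shapeInertia m) :=
  contDiff_const.add (contDiff_const.mul (contDiff_id.norm_sq ℝ))

lemma contDiff_ofReal : ContDiff ℝ ∞ (fun x : ℝ => (x : ℂ)) := Complex.ofRealCLM.contDiff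

lemma contDiff_conj : ContDiff ℝ ∞ (fun x : ℂ => conj x) :=
  Complex.conjCLE.toContinuousLinearMap.contDiff

lemma contDiffAt_shapeGrad (h1 : ζ + weight₁ m ≠ 0) (h2 : ζ - weight₀ m ≠ 0) :
    ContDiffAt ℝ ∞ (shapeGrad m a) ζ := by
  have key : ∀ (c d : ℝ) (w : ℂ), ζ + w ≠ 0 →
      ContDiffAt ℝ ∞ (fun ζ : ℂ => ((c / ‖ζ + w‖ ^ d : ℝ) : ℂ)) ζ := by
    intro c d w hw
    have h3 : ContDiffAt ℝ ∞ (fun ζ : ℂ => ‖ζ + w‖) ζ :=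
      (contDiffAt_id.add contDiffAt_const).norm ℝ hw
    exact contDiff_ofReal.contDiffAt.comp ζ (contDiffAt_const.div
      (h3.rpow_const_of_ne (norm_ne_zero_iff.2 hw)) (by positivity))
  have k1 := key (m 0 * m 2) (a + 2) (weight₁ m) h1
  have k2 := key (m 1 * m 2) (a + 2) (-weight₀ m) (by rwa [← sub_eq_add_neg])
  simp only [← sub_eq_add_neg] at k2
  unfold shapeGrad
  fun_prop

lemma contDiffAt_norm_shapeGrad (h : IsRegularShape m a ζ) :
    ContDiffAt ℝ ∞ (fun ζ => ‖shapeGrad m a ζ‖) ζ :=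
  (contDiffAt_shapeGrad h.1 h.2.1).norm ℝ h.2.2

lemma IsRegularShape.eventually (h : IsRegularShape m a ζ) : ∀ᶠ w in 𝓝 ζ, IsRegularShape m a w := by
  have h1 : ∀ᶠ w : ℂ in 𝓝 ζ, w + weight₁ m ≠ 0 :=
    (show ContinuousAt (fun w : ℂ => w + weight₁ m) ζ by fun_prop).eventually_ne h.1
  have h2 : ∀ᶠ w : ℂ in 𝓝 ζ, w - weight₀ m ≠ 0 :=
    (show ContinuousAt (fun w : ℂ => w - weight₀ m) ζ by fun_prop).eventually_ne h.2.1
  filter_upwards [h1, h2, (contDiffAt_shapeGrad h.1 h.2.1).continuousAt.eventually_ne h.2.2]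
    with w a1 a2 a3 using ⟨a1, a2, a3⟩

lemma contDiffAt_unitGrad (h : IsRegularShape m a ζ) : ContDiffAt ℝ ∞ (unitGrad m a) ζ := by
  have h1 : ContDiffAt ℝ ∞ (fun ζ => ((‖shapeGrad m a ζ‖ : ℝ) : ℂ)⁻¹) ζ :=
    (contDiff_ofReal.contDiffAt.comp ζ (contDiffAt_norm_shapeGrad h)).inv
      (Complex.ofReal_ne_zero.2 (norm_ne_zero_iff.2 h.2.2))
  exact (contDiffAt_shapeGrad h.1 h.2.1).mul h1

lemma contDiffAt_levelField (h : IsRegularShape m a ζ) : ContDiffAt ℝ ∞ (levelField m a) ζ :=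
  (contDiff_ofReal.contDiffAt.comp ζ (contDiff_shapeInertia m).contDiffAt).mul
    (contDiffAt_const.mul (contDiffAt_unitGrad h))

lemma contDiffAt_alongLevel {E : Type*} [NormedAddCommGroup E] [NormedSpace ℝ E] {f : ℂ → E}
    (h : IsRegularShape m a ζ) (hf : ContDiffAt ℝ ∞ f ζ) :
    ContDiffAt ℝ ∞ (alongLevel m a f) ζ :=
  (hf.fderiv_right (m := ∞) (by simp)).clm_apply (contDiffAt_levelField h)

lemma contDiffAt_turning (h : IsRegularShape m a ζ) : ContDiffAt ℝ ∞ (turning m a) ζ :=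
  Complex.imCLM.contDiff.contDiffAt.comp ζ
    ((contDiff_conj.contDiffAt.comp ζ (contDiffAt_unitGrad h)).mul
      (contDiffAt_alongLevel h (contDiffAt_unitGrad h)))

lemma contDiffAt_levelCurvature (h : IsRegularShape m a ζ) :
    ContDiffAt ℝ ∞ (levelCurvature m a) ζ :=
  (contDiffAt_turning h).sub (contDiffAt_const.mul
    (Complex.reCLM.contDiff.contDiffAt.comp ζ
      (contDiff_conj.contDiffAt.mul (contDiffAt_unitGrad h))))

lemma contDiffAt_slope (hm : ∀ k, 0 < m k) (h : IsRegularShape m a ζ) :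
    ContDiffAt ℝ ∞ (slope m a) ζ :=
  ((contDiff_shapeInertia m).contDiffAt.rpow_const_of_ne (shapeInertia_pos hm ζ).ne').mul
    ((contDiffAt_norm_shapeGrad h).div_const _)

lemma slope_pos (hm : ∀ k, 0 < m k) (h : IsRegularShape m a ζ) : 0 < slope m a ζ := by
  have := shapeInertia_pos hm ζ
  have := innerMass_pos hm
  have := outerMass_pos hm
  have := norm_pos_iff.2 h.2.2
  rw [slope]; positivity

lemma conj_mul_unitGrad (h : shapeGrad m a ζ ≠ 0) :
    conj (unitGrad m a ζ) * unitGrad m a ζ = 1 := by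
  have : ((‖shapeGrad m a ζ‖ : ℝ) : ℂ) ≠ 0 := by exact_mod_cast norm_ne_zero_iff.2 h
  rw [unitGrad, map_div₀, Complex.conj_ofReal, div_mul_div_comm, Complex.conj_mul', sq,
    div_self (mul_ne_zero this this)]

lemma norm_mul_unitGrad (h : shapeGrad m a ζ ≠ 0) :
    ((‖shapeGrad m a ζ‖ : ℝ) : ℂ) * unitGrad m a ζ = shapeGrad m a ζ :=
  mul_div_cancel₀ _ (by exact_mod_cast norm_ne_zero_iff.2 h)

/-- A curve along the level curves transports `alongLevel`. -/
lemma hasDerivAt_comp_levelField {E : Type*} [NormedAddCommGroup E] [NormedSpace ℝ E] {f : ℂ → E}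
    {x : ℝ → ℂ} {t c : ℝ} (hf : ContDiffAt ℝ ∞ f (x t))
    (hx : HasDerivAt x ((c : ℂ) * levelField m a (x t)) t) :
    HasDerivAt (fun s => f (x s)) (c • alongLevel m a f (x t)) t := by
  have h1 := (hf.differentiableAt (by simp)).hasFDerivAt.comp_hasDerivAt t hx
  refine h1.congr_deriv ?_
  rw [alongLevel, ← map_smul, Complex.real_smul]

/-- The normal has unit length, so its derivative is perpendicular to it; `turning` is the remaining
coefficient. -/
lemma alongLevel_unitGrad (h : IsRegularShape m a ζ) :
    alongLevel m a (unitGrad m a) ζ = Complex.I * turning m a ζ * unitGrad m a ζ := by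
  -- Only the first order matters, so the tangent line replaces the level curve.
  have hx : HasDerivAt (fun s : ℝ => ζ + (s : ℂ) * levelField m a ζ) (levelField m a ζ) 0 := by
    simpa using ((Complex.ofRealCLM.hasDerivAt (x := 0)).mul_const (levelField m a ζ)).const_add ζ
  have hx0 : (fun s : ℝ => ζ + (s : ℂ) * levelField m a ζ) 0 = ζ := by simp
  generalize (fun s : ℝ => ζ + (s : ℂ) * levelField m a ζ) = x at hx hx0
  have hN : HasDerivAt (fun s => unitGrad m a (x s)) (alongLevel m a (unitGrad m a) ζ) 0 := by
    have := hasDerivAt_comp_levelField (m := m) (a := a) (c := 1) (t := 0) (x := x)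
      (hf := hx0.symm ▸ contDiffAt_unitGrad h) (by simpa [hx0] using hx)
    simpa [hx0] using this
  have h1 : (fun s => conj (unitGrad m a (x s)) * unitGrad m a (x s)) =ᶠ[𝓝 0] fun _ => 1 := by
    have : Tendsto x (𝓝 0) (𝓝 ζ) := by simpa only [hx0] using hx.continuousAt.tendsto
    filter_upwards [this.eventually h.eventually] with s hs using conj_mul_unitGrad hs.2.2
  have h2 := ((hasDerivAt_conj hN).mul hN).unique
    ((hasDerivAt_const (0 : ℝ) (1 : ℂ)).congr_of_eventuallyEq h1)
  have h3 := congrArg Complex.re h2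
  rw [hx0] at h3
  have h4 : conj (unitGrad m a ζ) * alongLevel m a (unitGrad m a) ζ
      = Complex.I * turning m a ζ := by
    apply Complex.ext
    · simp at h3 ⊢; linarith
    · simp [turning]
  calc alongLevel m a (unitGrad m a) ζ
      = (conj (unitGrad m a ζ) * unitGrad m a ζ) * alongLevel m a (unitGrad m a) ζ := by
        rw [conj_mul_unitGrad h.2.2, one_mul]
    _ = conj (unitGrad m a ζ) * alongLevel m a (unitGrad m a) ζ * unitGrad m a ζ := by ring
    _ = _ := by rw [h4]

/-! ### Differentiation of the configurational measure along curves of shapes. -/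

lemma hasDerivAt_norm_sq {f : ℝ → ℂ} {f' : ℂ} {t : ℝ} (hf : HasDerivAt f f' t) :
    HasDerivAt (fun s => ‖f s‖ ^ 2) (2 * (conj (f t) * f').re) t := by
  refine hf.norm_sq.congr_deriv ?_
  rw [Complex.inner, mul_comm (f')]

lemma hasDerivAt_norm_rpow {f : ℝ → ℂ} {f' : ℂ} {t : ℝ} (b : ℝ) (hf : HasDerivAt f f' t)
    (h0 : f t ≠ 0) :
    HasDerivAt (fun s => ‖f s‖ ^ b) (b * ‖f t‖ ^ (b - 2) * (conj (f t) * f').re) t := by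
  have e : ∀ (c : ℝ) (w : ℂ), ‖w‖ ^ c = (‖w‖ ^ 2) ^ (c / 2) := fun c w => by
    rw [← Real.rpow_natCast, ← Real.rpow_mul (norm_nonneg _)]
    congr 1; push_cast; ring
  have h1 := (hasDerivAt_norm_sq hf).rpow_const (p := b / 2)
    (Or.inl (pow_ne_zero 2 (norm_ne_zero_iff.2 h0)))
  simp only [e b]
  refine h1.congr_deriv ?_
  rw [e (b - 2), sub_div, div_self two_ne_zero]; ring

lemma hasDerivAt_shapeInertia {x : ℝ → ℂ} {x' : ℂ} {t : ℝ} (hx : HasDerivAt x x' t) :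
    HasDerivAt (fun s => shapeInertia m (x s)) (2 * outerMass m * (conj (x t) * x').re) t :=
  (((hasDerivAt_norm_sq hx).const_mul _).const_add _).congr_deriv (by ring)

/-- This links the two roles of `shapeGrad`: the expression found in the equations of motion is, up
to the positive factor `R ^ (a / 2 - 1)`, the Euclidean gradient of the measure. -/
lemma hasDerivAt_shapeMeasure (hm : ∀ k, 0 < m k) (ha : 0 < a) {x : ℝ → ℂ} {x' : ℂ} {t : ℝ}
    (h1 : x t + weight₁ m ≠ 0) (h2 : x t - weight₀ m ≠ 0) (hx : HasDerivAt x x' t) :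
    HasDerivAt (fun s => shapeMeasure m a (x s))
      (shapeInertia m (x t) ^ (a / 2 - 1) * (conj (shapeGrad m a (x t)) * x').re) t := by
  have hR := shapeInertia_pos hm (x t)
  have d1 := hasDerivAt_norm_rpow (-a) (hx.add_const (weight₁ m : ℂ)) h1
  have d2 := hasDerivAt_norm_rpow (-a) (hx.sub_const (weight₀ m : ℂ)) h2
  have d3 := (hasDerivAt_shapeInertia (m := m) hx).rpow_const (p := a / 2) (Or.inl hR.ne')
  have d4 := (((((d1.const_mul (m 0 * m 2)).const_add (m 0 * m 1)).add
    (d2.const_mul (m 1 * m 2))).const_mul (1 / a)).mul d3)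
  have e : ∀ w : ℂ, ‖w‖ ^ (-a) = (‖w‖ ^ a)⁻¹ := fun w => Real.rpow_neg (norm_nonneg _) _
  simp only [e] at d4
  simp only [shapeMeasure, div_eq_mul_inv _ (‖_‖ ^ a)]
  refine d4.congr_deriv ?_
  have e' : ∀ w : ℂ, ‖w‖ ^ (-a - 2) = (‖w‖ ^ (a + 2))⁻¹ := fun w => by
    rw [← Real.rpow_neg (norm_nonneg _)]; ring_nf
  have e2 : ∀ w : ℂ, w ≠ 0 → (‖w‖ ^ a)⁻¹ = (‖w‖ ^ (a + 2))⁻¹ * ‖w‖ ^ 2 := fun w hw => by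
    have := norm_pos_iff.2 hw
    rw [Real.rpow_add this, Real.rpow_two]; field_simp
  have e3 : shapeInertia m (x t) ^ (a / 2)
      = shapeInertia m (x t) ^ (a / 2 - 1) * shapeInertia m (x t) := by
    rw [Real.rpow_sub_one hR.ne']; field_simp
  simp only [e', Pi.add_apply]
  rw [e2 _ h1, e2 _ h2, e3, shapeGrad, shapeInertia]
  simp only [Complex.sq_norm, Complex.normSq_apply, div_eq_mul_inv]
  generalize (‖x t + weight₁ m‖ ^ (a + 2))⁻¹ = P
  generalize (‖x t - weight₀ m‖ ^ (a + 2))⁻¹ = Q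
  simp only [map_add, map_sub, map_mul, Complex.conj_ofReal, Complex.add_re, Complex.add_im,
    Complex.sub_re, Complex.sub_im, Complex.mul_re, Complex.mul_im, Complex.conj_re,
    Complex.conj_im, Complex.ofReal_re, Complex.ofReal_im]
  field_simp
  ring

lemma eventually_eq_of_hasDerivAt_zero {E : Type*} [NormedAddCommGroup E] [NormedSpace ℝ E]
    {f : ℝ → E} {t₀ : ℝ} (hf : ∀ᶠ t in 𝓝 t₀, HasDerivAt f 0 t) : ∀ᶠ t in 𝓝 t₀, f t = f t₀ := by
  obtain ⟨ε, hε, h⟩ := Metric.eventually_nhds_iff_ball.1 hf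
  filter_upwards [Metric.ball_mem_nhds t₀ hε] with t ht
  exact (convex_ball t₀ ε).is_const_of_fderivWithin_eq_zero (𝕜 := ℝ)
    (fun s hs => (h s hs).differentiableAt.differentiableWithinAt)
    (fun s hs => by
      rw [fderivWithin_of_isOpen Metric.isOpen_ball hs]
      simpa using (h s hs).hasFDerivAt.fderiv) ht (Metric.mem_ball_self hε)

end PlanarBody
end

noncomputable section

namespace PlanarBody

open ComplexConjugate Filter Topology

open scoped ContDiff

variable {m : Fin 3 → ℝ} {a : ℝ} {J : Set ℝ} {q p : ℝ → Fin 3 → ℂ} {t : ℝ}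

/-! ### The reduced motion -/

/-- The area velocity `z ρ' - ρ z'` of the Jacobi vectors. -/
def shapeMomentum (m : Fin 3 → ℝ) (q p : Fin 3 → ℂ) : ℂ :=
  innerVec q * outerVec m (velocity m p) - outerVec m q * innerVec (velocity m p)

lemma IsSolution.hasDerivAt_shape (h : IsSolution m a J q p) (ht : t ∈ J) :
    HasDerivAt (fun s => shape m (q s))
      (shapeMomentum m (q t) (p t) / innerVec (q t) ^ 2) t := by
  refine ((hasDerivAt_outerVec (m := m) (h.position t ht)).div
    (hasDerivAt_innerVec (h.position t ht))
    (innerVec_ne_zero (h.configuration t ht).1)).congr_deriv ?_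
  rw [shapeMomentum, mul_comm (innerVec (q t))]
  rfl

lemma IsSolution.hasDerivAt_shapeMomentum (h : IsSolution m a J q p) (ht : t ∈ J) :
    HasDerivAt (fun s => shapeMomentum m (q s) (p s))
      (innerVec (q t) * outerVec m (acceleration m a (q t))
        - outerVec m (q t) * innerVec (acceleration m a (q t))) t := by
  refine (((hasDerivAt_innerVec (h.position t ht)).mul
    (hasDerivAt_outerVec (m := m) (h.hasDerivAt_velocity ht))).sub
    ((hasDerivAt_outerVec (m := m) (h.position t ht)).mul
    (hasDerivAt_innerVec (h.hasDerivAt_velocity ht)))).congr_deriv ?_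
  change innerVec (velocity m (p t)) * outerVec m (velocity m (p t)) + _ -
    (outerVec m (velocity m (p t)) * innerVec (velocity m (p t)) + _) = _
  ring

lemma IsSolution.wedge_acceleration_eq (h : IsSolution m a J q p) (hm : ∀ k, 0 < m k) (ht : t ∈ J) :
    innerVec (q t) * outerVec m (acceleration m a (q t))
        - outerVec m (q t) * innerVec (acceleration m a (q t)) =
      (((‖innerVec (q t)‖ ^ (a + 2))⁻¹ / (innerMass m * outerMass m) : ℝ) : ℂ) *
        innerVec (q t) ^ 2 * shapeGrad m a (shape m (q t)) := by
  have h1 : (innerMass m : ℂ) ≠ 0 := by exact_mod_cast (innerMass_pos hm).ne'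
  have h2 : (outerMass m : ℂ) ≠ 0 := by exact_mod_cast (outerMass_pos hm).ne'
  rw [← mul_right_inj' (mul_ne_zero h1 h2), wedge_acceleration_shape hm (h.configuration t ht).1]
  push_cast
  field_simp

lemma IsSolution.shapeMomentum_orthogonal (h : IsSolution m a J q p) (hm : ∀ k, 0 < m k)
    (ha : 0 < a) (hJ : IsOpen J) (ht : t ∈ J) {μ : ℝ} (hμ : ∀ s ∈ J, configMeasure m a (q s) = μ) :
    (conj (shapeGrad m a (shape m (q t)))
      * (shapeMomentum m (q t) (p t) / innerVec (q t) ^ 2)).re = 0 := by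
  obtain ⟨h1, h2⟩ := shape_ne hm (h.configuration t ht).1
  have hR := shapeInertia_pos hm (shape m (q t))
  have d := hasDerivAt_shapeMeasure (x := fun s => shape m (q s)) hm ha h1 h2 (h.hasDerivAt_shape ht)
  have e : (fun s => shapeMeasure m a (shape m (q s))) =ᶠ[𝓝 t] fun _ => μ := by
    filter_upwards [hJ.mem_nhds ht] with s hs
    rw [← configMeasure_eq_shape hm (h.configuration s hs), hμ s hs]
  have := d.unique ((hasDerivAt_const t μ).congr_of_eventuallyEq e)
  exact (mul_eq_zero.1 this).resolve_left (by positivity)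

/-- With `w = z² ζ'` and `w'` a real multiple of `z²` times the gradient, `Re (w̄ w')` is a real
multiple of the product of the gradient with `ζ'`, which vanishes because `μ` is constant. -/
lemma IsSolution.eventually_norm_shapeMomentum (h : IsSolution m a J q p) (hm : ∀ k, 0 < m k)
    (ha : 0 < a) (hJ : IsOpen J) {t₀ : ℝ} (ht₀ : t₀ ∈ J) {μ : ℝ}
    (hμ : ∀ s ∈ J, configMeasure m a (q s) = μ) :
    ∀ᶠ t in 𝓝 t₀, ‖shapeMomentum m (q t) (p t)‖ ^ 2 = ‖shapeMomentum m (q t₀) (p t₀)‖ ^ 2 := by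
  refine eventually_eq_of_hasDerivAt_zero
    (f := fun t => ‖shapeMomentum m (q t) (p t)‖ ^ 2) ?_
  filter_upwards [hJ.mem_nhds ht₀] with t ht
  refine (hasDerivAt_norm_sq (h.hasDerivAt_shapeMomentum ht)).congr_deriv ?_
  have hz := innerVec_ne_zero (h.configuration t ht).1
  have o := h.shapeMomentum_orthogonal hm ha hJ ht hμ
  rw [h.wedge_acceleration_eq hm ht]
  generalize (‖innerVec (q t)‖ ^ (a + 2))⁻¹ / (innerMass m * outerMass m) = c
  generalize shapeGrad m a (shape m (q t)) = g at *
  generalize hw : shapeMomentum m (q t) (p t) / innerVec (q t) ^ 2 = w at o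
  rw [div_eq_iff (pow_ne_zero 2 hz)] at hw
  rw [hw]
  generalize innerVec (q t) = z
  have : conj (w * z ^ 2) * (c * z ^ 2 * g) = ((c * (‖z‖ ^ 2) ^ 2 : ℝ) : ℂ) * (conj (conj g * w)) := by
    push_cast
    rw [← Complex.conj_mul']
    simp only [map_mul, map_pow, Complex.conj_conj]
    ring
  rw [this, Complex.re_ofReal_mul, Complex.conj_re, o, mul_zero, mul_zero]

/-- The component of the shape velocity along the level curve, in the time `∫ dt / I`. -/
def levelSpeed (m : Fin 3 → ℝ) (a : ℝ) (q p : Fin 3 → ℂ) : ℝ :=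
  ‖innerVec q‖ ^ 2 * (conj (Complex.I * unitGrad m a (shape m q))
    * (shapeMomentum m q p / innerVec q ^ 2)).re

lemma eq_of_orthogonal {N w : ℂ} (hN : conj N * N = 1) (h : (conj N * w).re = 0) :
    w = ((conj (Complex.I * N) * w).re : ℂ) * (Complex.I * N) := by
  have : conj N * w = ((conj (Complex.I * N) * w).re : ℂ) * Complex.I := by
    apply Complex.ext
    · rw [h]; simp
    · simp
      ring
  calc w = (conj N * N) * w := by rw [hN, one_mul]
    _ = conj N * w * N := by ring
    _ = _ := by rw [this]; ring

/-- Tangency to the level curve, written without denominators so that both sides can be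
differentiated by the product rule. -/
lemma IsSolution.shapeMomentum_eq (h : IsSolution m a J q p) (hm : ∀ k, 0 < m k)
    (ha : 0 < a) (hJ : IsOpen J) (ht : t ∈ J) {μ : ℝ} (hμ : ∀ s ∈ J, configMeasure m a (q s) = μ)
    (hr : IsRegularShape m a (shape m (q t))) :
    shapeMomentum m (q t) (p t) * conj (innerVec (q t)) =
      levelSpeed m a (q t) (p t) * (Complex.I * unitGrad m a (shape m (q t))) * innerVec (q t) := by
  have hz := innerVec_ne_zero (h.configuration t ht).1
  have o := h.shapeMomentum_orthogonal hm ha hJ ht hμ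
  have o' : (conj (unitGrad m a (shape m (q t)))
      * (shapeMomentum m (q t) (p t) / innerVec (q t) ^ 2)).re = 0 := by
    rw [← norm_mul_unitGrad hr.2.2, map_mul, Complex.conj_ofReal, mul_assoc,
      Complex.re_ofReal_mul] at o
    exact (mul_eq_zero.1 o).resolve_left (norm_ne_zero_iff.2 hr.2.2)
  have e := eq_of_orthogonal (conj_mul_unitGrad hr.2.2) o'
  rw [levelSpeed]
  generalize (conj (Complex.I * unitGrad m a (shape m (q t)))
    * (shapeMomentum m (q t) (p t) / innerVec (q t) ^ 2)).re = x at *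
  rw [div_eq_iff (pow_ne_zero 2 hz)] at e
  rw [e]
  push_cast
  rw [← Complex.conj_mul']
  ring

lemma IsSolution.sq_levelSpeed (h : IsSolution m a J q p) (hm : ∀ k, 0 < m k)
    (ha : 0 < a) (hJ : IsOpen J) (ht : t ∈ J) {μ : ℝ} (hμ : ∀ s ∈ J, configMeasure m a (q s) = μ)
    (hr : IsRegularShape m a (shape m (q t))) :
    levelSpeed m a (q t) (p t) ^ 2 = ‖shapeMomentum m (q t) (p t)‖ ^ 2 := by
  have hz := norm_pos_iff.2 (innerVec_ne_zero (h.configuration t ht).1)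
  have hN : ‖unitGrad m a (shape m (q t))‖ = 1 := by
    have := congrArg norm (conj_mul_unitGrad hr.2.2)
    rw [norm_mul, RCLike.norm_conj, norm_one] at this
    nlinarith [norm_nonneg (unitGrad m a (shape m (q t)))]
  have := congrArg norm (h.shapeMomentum_eq hm ha hJ ht hμ hr)
  simp only [norm_mul, RCLike.norm_conj, hN, Complex.norm_I, mul_one, Complex.norm_real] at this
  rw [mul_left_inj' hz.ne'] at this
  rw [this, Real.norm_eq_abs, sq_abs]

lemma IsSolution.continuousAt_levelSpeed (h : IsSolution m a J q p) (ht : t ∈ J)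
    (hr : IsRegularShape m a (shape m (q t))) :
    ContinuousAt (fun s => levelSpeed m a (q s) (p s)) t := by
  have c1 : ContinuousAt (fun s => innerVec (q s)) t :=
    (hasDerivAt_innerVec (h.position t ht)).continuousAt
  have c2 : ContinuousAt (fun s => shapeMomentum m (q s) (p s)) t :=
    (h.hasDerivAt_shapeMomentum ht).continuousAt
  have c3 : ContinuousAt (fun s => unitGrad m a (shape m (q s))) t :=
    (contDiffAt_unitGrad hr).continuousAt.comp (f := fun s => shape m (q s))
      (h.hasDerivAt_shape ht).continuousAt
  have hz := pow_ne_zero 2 (innerVec_ne_zero (h.configuration t ht).1)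
  have c4 : ContinuousAt (fun s => conj (Complex.I * unitGrad m a (shape m (q s)))
      * (shapeMomentum m (q s) (p s) / innerVec (q s) ^ 2)) t :=
    (Complex.continuous_conj.continuousAt.comp (continuousAt_const.mul c3)).mul
      (c2.div (c1.pow 2) hz)
  exact (c1.norm.pow 2).mul (Complex.continuous_re.continuousAt.comp c4)

lemma IsSolution.eventually_isRegularShape (h : IsSolution m a J q p) (ht : t ∈ J)
    (hr : IsRegularShape m a (shape m (q t))) :
    ∀ᶠ s in 𝓝 t, IsRegularShape m a (shape m (q s)) :=
  (h.hasDerivAt_shape ht).continuousAt.tendsto.eventually hr.eventually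

/-- The square is constant; continuity and `h0` exclude a change of sign. -/
lemma IsSolution.eventually_levelSpeed (h : IsSolution m a J q p) (hm : ∀ k, 0 < m k)
    (ha : 0 < a) (hJ : IsOpen J) {t₀ : ℝ} (ht₀ : t₀ ∈ J) {μ : ℝ}
    (hμ : ∀ s ∈ J, configMeasure m a (q s) = μ) (hr : IsRegularShape m a (shape m (q t₀)))
    (h0 : levelSpeed m a (q t₀) (p t₀) ≠ 0) :
    ∀ᶠ t in 𝓝 t₀, levelSpeed m a (q t) (p t) = levelSpeed m a (q t₀) (p t₀) := by
  have c : ContinuousAt (fun s => levelSpeed m a (q s) (p s) * levelSpeed m a (q t₀) (p t₀)) t₀ :=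
    (h.continuousAt_levelSpeed ht₀ hr).mul continuousAt_const
  filter_upwards [hJ.mem_nhds ht₀, h.eventually_isRegularShape ht₀ hr,
    h.eventually_norm_shapeMomentum hm ha hJ ht₀ hμ,
    c.eventually (lt_mem_nhds (mul_self_pos.2 h0))] with t ht hrt e hpos
  rw [← h.sq_levelSpeed hm ha hJ ht hμ hrt, ← h.sq_levelSpeed hm ha hJ ht₀ hμ hr] at e
  rcases sq_eq_sq_iff_eq_or_eq_neg.1 e with e | e
  · exact e
  · rw [e] at hpos
    nlinarith [mul_self_pos.2 h0]

lemma IsSolution.eventually_angularMomentum (h : IsSolution m a J q p) (hm : ∀ k, 0 < m k)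
    (ha : 0 < a) (hJ : IsOpen J) {t₀ : ℝ} (ht₀ : t₀ ∈ J) :
    ∀ᶠ t in 𝓝 t₀, angularMomentum (q t) (p t) = angularMomentum (q t₀) (p t₀) := by
  refine eventually_eq_of_hasDerivAt_zero (f := fun t => angularMomentum (q t) (p t)) ?_
  filter_upwards [hJ.mem_nhds ht₀] with t ht using h.hasDerivAt_angularMomentum hm ha ht

/-- The equation for the rate of rotation of the normal to the level curve, in algebraic form. -/
lemma normal_equation {z u N ζ : ℂ} {x y τ n C R A : ℝ} (hz : z ≠ 0) (hN : conj N * N = 1)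
    (hR : R = x + y * ‖ζ‖ ^ 2) (hI : ‖z‖ ^ 2 * R ≠ 0)
    (hC : C = ((x : ℂ) * (conj z * u) + y * (conj (z * ζ) *
      (u * ζ + z * ((τ / (‖z‖ ^ 2 * R) : ℝ) * (R * (Complex.I * N)))))).im)
    (h : (A * (z ^ 2 * N)) * conj z + (τ * (Complex.I * N) * z) * (conj u / conj z) =
      τ * (Complex.I * ((τ / (‖z‖ ^ 2 * R) : ℝ) * (Complex.I * n * N))) * z
        + τ * (Complex.I * N) * u) :
    ‖z‖ ^ 2 * R * (A * ‖z‖ ^ 2) + τ ^ 2 * (n - 2 * y * (conj ζ * N).re) = -2 * τ * C := by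
  obtain ⟨v, rfl⟩ : ∃ v, u = z * v := ⟨u / z, by field_simp⟩
  have hN0 : N ≠ 0 := by rintro rfl; simp at hN
  have hz' : conj z ≠ 0 := by simpa using hz
  have hR0 : R ≠ 0 := right_ne_zero_of_mul hI
  have hzz : ‖z‖ ^ 2 ≠ 0 := left_ne_zero_of_mul hI
  have hRC : (R : ℂ) ≠ 0 := Complex.ofReal_ne_zero.2 hR0
  have hzn : ((‖z‖ : ℝ) : ℂ) ^ 2 ≠ 0 := by exact_mod_cast hzz
  -- the imaginary part of `u / z`
  have e1 : C = ‖z‖ ^ 2 * R * v.im + y * τ * (conj ζ * N).re := by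
    have : (x : ℂ) * (conj z * (z * v)) + y * (conj (z * ζ) *
        (z * v * ζ + z * ((τ / (‖z‖ ^ 2 * R) : ℝ) * (R * (Complex.I * N))))) =
        ((‖z‖ ^ 2 * R : ℝ) : ℂ) * v + ((y * τ : ℝ) : ℂ) * (Complex.I * (conj ζ * N)) := by
      have e : ((‖z‖ : ℝ) : ℂ) ^ 2 = conj z * z := (Complex.conj_mul' z).symm
      have e' : ((‖ζ‖ : ℝ) : ℂ) ^ 2 = conj ζ * ζ := (Complex.conj_mul' ζ).symm
      have hR' : (R : ℂ) = x + y * (conj ζ * ζ) := by rw [hR, ← e']; push_cast; ring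
      push_cast
      rw [map_mul, e]
      field_simp
      rw [hR']
      ring
    rw [hC, this, Complex.add_im, Complex.im_ofReal_mul, Complex.im_ofReal_mul]
    simp
  -- The hypothesis `h` divided by `z N`. Its imaginary part is trivial; its real part determines
  -- `v.im`, the angular velocity of `z`, which `e1` trades for `C`.
  have e2 : ((A * ‖z‖ ^ 2 : ℝ) : ℂ) + τ * Complex.I * conj v
      = -((τ ^ 2 * n / (‖z‖ ^ 2 * R) : ℝ) : ℂ) + τ * Complex.I * v := by
    have hfac : z * N ≠ 0 := mul_ne_zero hz hN0
    rw [← mul_left_inj' hfac]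
    rw [map_mul] at h
    push_cast at h ⊢
    rw [← Complex.conj_mul' z] at *
    have h' : conj z * conj v / conj z = conj v := by field_simp
    rw [h'] at h
    linear_combination h + (τ ^ 2 * n / (conj z * z * R) * N * z) * Complex.I_sq
  have e3 := congrArg Complex.re e2
  simp only [Complex.add_re, Complex.neg_re, Complex.ofReal_re, Complex.mul_re, Complex.mul_im,
    Complex.I_re, Complex.I_im, Complex.ofReal_im, Complex.conj_re, Complex.conj_im] at e3
  have e4 : A * ‖z‖ ^ 2 = -(τ ^ 2 * n / (‖z‖ ^ 2 * R)) - 2 * τ * v.im := by linarith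
  rw [e4, e1]
  field_simp
  ring

/-- A motion of constant configurational measure: its shape follows the level curve at constant
speed `τ` in the time `∫ dt / I`, and the normal component of the equations of motion holds. -/
theorem IsSolution.reduced_motion (h : IsSolution m a J q p) (hm : ∀ k, 0 < m k)
    (ha : 0 < a) (hJ : IsOpen J) {t₀ : ℝ} (ht₀ : t₀ ∈ J) {μ : ℝ}
    (hμ : ∀ s ∈ J, configMeasure m a (q s) = μ) (hr : IsRegularShape m a (shape m (q t₀)))
    (hB : 0 < integralB m a q p t₀ - angularMomentum (q t₀) (p t₀) ^ 2) :
    ∃ τ : ℝ, τ ≠ 0 ∧ innerMass m * outerMass m * τ ^ 2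
        = integralB m a q p t₀ - angularMomentum (q t₀) (p t₀) ^ 2 ∧
      ∀ᶠ t in 𝓝 t₀, HasDerivAt (fun s => shape m (q s))
          (((τ / inertia m (q t) : ℝ) : ℂ) * levelField m a (shape m (q t))) t ∧
        inertia m (q t) ^ ((2 - a) / 2) * slope m a (shape m (q t))
          + τ ^ 2 * levelCurvature m a (shape m (q t))
          = -2 * τ * angularMomentum (q t₀) (p t₀) := by
  have hM := mul_pos (innerMass_pos hm) (outerMass_pos hm)
  have hspeed := h.sq_levelSpeed hm ha hJ ht₀ hμ hr
  have hBeq := h.integralB_sub hm hJ ht₀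
  rw [← shapeMomentum, ← hspeed] at hBeq
  rw [hBeq] at hB ⊢
  have hτ : levelSpeed m a (q t₀) (p t₀) ≠ 0 := by
    intro h0
    rw [h0] at hB; simp at hB
  have hconst := h.eventually_levelSpeed hm ha hJ ht₀ hμ hr hτ
  refine ⟨_, hτ, rfl, ?_⟩
  generalize levelSpeed m a (q t₀) (p t₀) = τ at *
  have hmom : ∀ᶠ t in 𝓝 t₀, shapeMomentum m (q t) (p t) * conj (innerVec (q t)) =
      τ * (Complex.I * unitGrad m a (shape m (q t))) * innerVec (q t) := by
    filter_upwards [hJ.mem_nhds ht₀, h.eventually_isRegularShape ht₀ hr, hconst] with t ht hrt e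
    rw [h.shapeMomentum_eq hm ha hJ ht hμ hrt, e]
  filter_upwards [hJ.mem_nhds ht₀, h.eventually_isRegularShape ht₀ hr, hmom.eventually_nhds,
    h.eventually_angularMomentum hm ha hJ ht₀] with t ht hrt hmom hC
  have hconf := h.configuration t ht
  have hz := innerVec_ne_zero hconf.1
  have hz' : conj (innerVec (q t)) ≠ 0 := by simpa using hz
  have hR := shapeInertia_pos hm (shape m (q t))
  have hzz : 0 < ‖innerVec (q t)‖ := norm_pos_iff.2 hz
  have hI : inertia m (q t) = ‖innerVec (q t)‖ ^ 2 * shapeInertia m (shape m (q t)) :=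
    inertia_eq_shape hm hconf
  have hmom_t := hmom.self_of_nhds
  have hval : shapeMomentum m (q t) (p t) / innerVec (q t) ^ 2 =
      ((τ / inertia m (q t) : ℝ) : ℂ) * levelField m a (shape m (q t)) := by
    rw [← eq_div_iff hz'] at hmom_t
    have hRC : (shapeInertia m (shape m (q t)) : ℂ) ≠ 0 := by exact_mod_cast hR.ne'
    rw [hmom_t, hI, levelField]
    push_cast
    rw [← Complex.conj_mul']
    field_simp
  have hshape : HasDerivAt (fun s => shape m (q s))
      (((τ / inertia m (q t) : ℝ) : ℂ) * levelField m a (shape m (q t))) t :=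
    (h.hasDerivAt_shape ht).congr_deriv hval
  refine ⟨hshape, ?_⟩
  have hN := hasDerivAt_comp_levelField (x := fun s => shape m (q s))
    (contDiffAt_unitGrad hrt) hshape
  have hu := hasDerivAt_innerVec (h.position t ht)
  -- The two sides of the tangency relation `hmom` are differentiated separately: one through the
  -- force, the other through the turning of the normal.
  have d1 := (h.hasDerivAt_shapeMomentum ht).mul (hasDerivAt_conj hu)
  have d2 := (((hN.const_mul Complex.I).const_mul (τ : ℂ)).mul hu)
  have d := d1.unique (d2.congr_of_eventuallyEq hmom)
  have hu' : innerVec (fun k => p t k / (m k : ℂ)) = innerVec (velocity m (p t)) := rfl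
  rw [h.wedge_acceleration_eq hm ht, hu', alongLevel_unitGrad hrt, ← norm_mul_unitGrad hrt.2.2,
    Complex.real_smul] at d
  set A : ℝ := (‖innerVec (q t)‖ ^ (a + 2))⁻¹ / (innerMass m * outerMass m)
    * ‖shapeGrad m a (shape m (q t))‖ with hA
  have hAM : ‖innerVec (q t)‖ ^ 2 * shapeInertia m (shape m (q t)) * (A * ‖innerVec (q t)‖ ^ 2) =
      inertia m (q t) ^ ((2 - a) / 2) * slope m a (shape m (q t)) := by
    rw [hI, slope, hA, Real.mul_rpow (by positivity) hR.le, ← Real.rpow_natCast _ 2,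
      ← Real.rpow_mul hzz.le, Real.rpow_add hzz]
    have e1 : ((2 : ℕ) : ℝ) * ((2 - a) / 2) = ((2 : ℕ) : ℝ) - a := by push_cast; ring
    have e2 : (2 - a) / 2 = 1 - a / 2 := by ring
    rw [e1, e2, Real.rpow_sub hzz, Real.rpow_sub hR, Real.rpow_one, Real.rpow_natCast,
      Real.rpow_two]
    have := innerMass_pos hm
    have := outerMass_pos hm
    field_simp
  rw [← hAM, levelCurvature]
  have hout := h.sum_momentum_eq_zero hm hJ ht
  refine normal_equation (u := innerVec (velocity m (p t))) (x := innerMass m) hz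
    (conj_mul_unitGrad hrt.2.2) rfl (by positivity) ?_ ?_
  · rw [← hC, angularMomentum_eq_im, sum_conj_mul_momentum hm hconf.2 hout, outerVec_eq hconf.1]
    have e : outerVec m (velocity m (p t)) = innerVec (velocity m (p t)) * shape m (q t)
        + innerVec (q t) * (((τ / inertia m (q t) : ℝ) : ℂ) * levelField m a (shape m (q t))) := by
      rw [← hval, shapeMomentum, outerVec_eq hconf.1]
      field_simp
      ring
    rw [e, hI, levelField]
  · rw [← eq_div_iff hz'] at hmom_t
    rw [← hI]
    rw [hmom_t] at d
    rw [hA]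
    push_cast at d ⊢
    linear_combination d

end PlanarBody
end

noncomputable section

namespace PlanarBody

open ComplexConjugate Filter Topology

open scoped ContDiff

variable {m : Fin 3 → ℝ} {a : ℝ}

/-! ### The potentials of degree other than `-2` -/

/-- Small speeds along the level curve are incompatible with the virial inequality. -/
lemma exists_speed_bound {b φ₀ φ₁ φ₂ k₀ k₁ k₂ I₀ w e e' U : ℝ} (hb : b ≠ 0) (hφ : 0 < φ₀)
    (hI : 0 < I₀) (hw : 0 < w) :
    ∃ ε > 0, ∀ τ C y y' : ℝ, |τ| < ε → w * φ₀ + τ ^ 2 * k₀ = -2 * τ * C →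
      b * y * φ₀ + τ * φ₁ + τ ^ 3 * (e * k₁) = 0 →
      b * (y' * φ₀ + y * (τ / I₀ * φ₁)) + τ * (τ / I₀ * φ₂)
        + τ ^ 3 * (y * -b * e' * k₁ + e * (τ / I₀ * k₂)) = 0 →
      y' < 2 * C ^ 2 / I₀ - 2 * U := by
  set Y : ℝ → ℝ := fun τ => -(φ₁ + τ ^ 2 * (e * k₁)) / (b * φ₀) with hY
  set Y' : ℝ → ℝ := fun τ => -(b * (Y τ * (φ₁ / I₀)) + φ₂ / I₀
    + τ ^ 2 * (Y τ * -b * e' * k₁ + e * (k₂ / I₀))) / (b * φ₀) with hY'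
  -- This is `τ²` times the difference of the two sides of the claim, with `C` eliminated by the
  -- first hypothesis. It is continuous and negative at `τ = 0`.
  set F : ℝ → ℝ := fun τ => τ ^ 4 * Y' τ + 2 * U * τ ^ 2 - (w * φ₀ + τ ^ 2 * k₀) ^ 2 / (2 * I₀)
    with hF
  have hc : Continuous F := by
    have : Continuous Y := by rw [hY]; fun_prop
    have : Continuous Y' := by rw [hY']; fun_prop
    rw [hF]; fun_prop
  have h0 : F 0 < 0 := by
    have : F 0 = -((w * φ₀) ^ 2 / (2 * I₀)) := by simp [hF]
    rw [this, neg_lt_zero]; positivity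
  obtain ⟨ε, hε, h⟩ := Metric.eventually_nhds_iff.1 (hc.continuousAt.eventually (gt_mem_nhds h0))
  refine ⟨ε, hε, fun τ C y y' hτ h1 h2 h3 => ?_⟩
  have hτF : F τ < 0 := h (by simpa using hτ)
  have hbφ : b * φ₀ ≠ 0 := mul_ne_zero hb hφ.ne'
  have ey : y = τ * Y τ := by
    rw [hY]; field_simp; linear_combination h2
  have ey' : y' = τ ^ 2 * Y' τ := by
    rw [ey] at h3
    rw [hY']; field_simp at h3 ⊢; linear_combination h3
  have hne : τ ≠ 0 := by
    rintro rfl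
    have : w * φ₀ = 0 := by simpa using h1
    exact (mul_pos hw hφ).ne' this
  have hF' : F τ = τ ^ 2 * (y' + 2 * U - 2 * C ^ 2 / I₀) := by
    rw [ey', hF]; simp only []
    rw [h1]; field_simp
  rw [hF'] at hτF
  have := (mul_neg_iff.1 hτF).resolve_right (fun h => absurd h.1 (not_lt.2 (sq_nonneg τ)))
  linarith [this.2]

/-- All coefficients passed to `exists_speed_bound` are values at `q₀`, so the bound on `|τ|`
depends on no particular motion. -/
theorem exists_bound_of_ne_two (hm : ∀ k, 0 < m k) (ha : 0 < a) (ha2 : a ≠ 2) {q₀ : Fin 3 → ℂ}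
    (hq₀ : IsConfiguration m q₀) (hr : IsRegularShape m a (shape m q₀)) :
    ∃ δ > 0, ∀ (J : Set ℝ) (t₀ : ℝ) (q p : ℝ → Fin 3 → ℂ), IsOpen J → t₀ ∈ J →
      IsSolution m a J q p → q t₀ = q₀ →
      (∀ t ∈ J, configMeasure m a (q t) = configMeasure m a (q t₀)) →
      0 < integralB m a q p t₀ - angularMomentum (q t₀) (p t₀) ^ 2 →
      δ ≤ integralB m a q p t₀ - angularMomentum (q t₀) (p t₀) ^ 2 := by
  have hM := mul_pos (innerMass_pos hm) (outerMass_pos hm)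
  have hI₀ := inertia_pos hm hq₀.1
  set b := (2 - a) / 2 with hbdef
  have hb : b ≠ 0 := div_ne_zero (sub_ne_zero.2 ha2.symm) two_ne_zero
  obtain ⟨ε, hε, H⟩ := exists_speed_bound (φ₀ := slope m a (shape m q₀))
    (φ₁ := alongLevel m a (slope m a) (shape m q₀))
    (φ₂ := alongLevel m a (alongLevel m a (slope m a)) (shape m q₀))
    (k₀ := levelCurvature m a (shape m q₀))
    (k₁ := alongLevel m a (levelCurvature m a) (shape m q₀))
    (k₂ := alongLevel m a (alongLevel m a (levelCurvature m a)) (shape m q₀))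
    (e := inertia m q₀ ^ (-b)) (e' := inertia m q₀ ^ (-b - 1)) (w := inertia m q₀ ^ b)
    (U := a * potential m a q₀)
    hb (slope_pos hm hr) hI₀ (by positivity)
  refine ⟨innerMass m * outerMass m * ε ^ 2, by positivity, ?_⟩
  intro J t₀ q p hJ ht₀ h hq hμ hB
  subst hq
  obtain ⟨τ, hτ, hτB, hev⟩ := h.reduced_motion hm ha hJ ht₀ hμ hr hB
  rw [← hτB]
  by_contra! hlt
  have hτε : |τ| < ε := abs_lt_of_sq_lt_sq (lt_of_mul_lt_mul_left hlt hM.le) hε.le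
  have hreg := h.eventually_isRegularShape ht₀ hr
  have hJn := hJ.mem_nhds ht₀
  -- The time derivative of the normal equation, multiplied by `I ^ (1 - b)`. It is needed on a
  -- neighbourhood because it is differentiated once more.
  have E1 : ∀ᶠ t in 𝓝 t₀, b * (2 * (∑ k, conj (q t k) * p t k).re) * slope m a (shape m (q t))
      + τ * alongLevel m a (slope m a) (shape m (q t))
      + τ ^ 3 * (inertia m (q t) ^ (-b) * alongLevel m a (levelCurvature m a) (shape m (q t)))
      = 0 := by
    filter_upwards [hJn, hreg, hev.eventually_nhds] with t ht hrt hevt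
    have hI := inertia_pos hm (h.configuration t ht).1
    have hs := hevt.self_of_nhds.1
    have d1 := ((h.hasDerivAt_inertia hm ht).rpow_const (p := b) (Or.inl hI.ne')).mul
      (hasDerivAt_comp_levelField (x := fun s => shape m (q s)) (contDiffAt_slope hm hrt) hs)
    have d2 := (hasDerivAt_comp_levelField (x := fun s => shape m (q s))
      (contDiffAt_levelCurvature hrt) hs).const_mul (τ ^ 2)
    have d := (d1.add d2).unique ((hasDerivAt_const t
      (-2 * τ * angularMomentum (q t₀) (p t₀))).congr_of_eventuallyEq
        (hevt.mono fun s hs => hs.2))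
    have e1 : inertia m (q t) ^ (b - 1) = inertia m (q t) ^ b / inertia m (q t) :=
      Real.rpow_sub_one hI.ne' b
    have e2 : inertia m (q t) ^ (-b) = (inertia m (q t) ^ b)⁻¹ := Real.rpow_neg hI.le b
    have hIb : 0 < inertia m (q t) ^ b := by positivity
    simp only [smul_eq_mul] at d
    rw [e1] at d
    rw [e2]
    field_simp at d ⊢
    linear_combination d
  have hs := hev.self_of_nhds.1
  have d1 := ((h.hasDerivAt_deriv_inertia hm ha ht₀).const_mul b).mul
      (hasDerivAt_comp_levelField (x := fun s => shape m (q s)) (contDiffAt_slope hm hr) hs)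
  have d2 := (hasDerivAt_comp_levelField (x := fun s => shape m (q s))
      (contDiffAt_alongLevel hr (contDiffAt_slope hm hr)) hs).const_mul τ
  have d3 := (((h.hasDerivAt_inertia hm ht₀).rpow_const (p := -b) (Or.inl hI₀.ne')).mul
      (hasDerivAt_comp_levelField (x := fun s => shape m (q s))
      (contDiffAt_alongLevel hr (contDiffAt_levelCurvature hr)) hs)).const_mul (τ ^ 3)
  have d := ((d1.add d2).add d3).unique ((hasDerivAt_const t₀ (0 : ℝ)).congr_of_eventuallyEq E1)
  simp only [smul_eq_mul] at d
  have hfin := H τ (angularMomentum (q t₀) (p t₀)) (2 * (∑ k, conj (q t₀ k) * p t₀ k).re)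
    (4 * kinetic m (p t₀) - 2 * a * potential m a (q t₀)) hτε hev.self_of_nhds.2
    E1.self_of_nhds (by linear_combination d)
  have hk := sq_angularMomentum_le hm (h.configuration t₀ ht₀).2 (h.sum_momentum_eq_zero hm hJ ht₀)
  have : 2 * angularMomentum (q t₀) (p t₀) ^ 2 / inertia m (q t₀) ≤ 4 * kinetic m (p t₀) := by
    rw [div_le_iff₀ hI₀]; linarith
  linarith

end PlanarBody
end

noncomputable section

namespace PlanarBody

open ComplexConjugate Filter Topology

/-! ### Time changes of integral curves -/

lemma exists_primitive {c : ℝ → ℝ} {t₀ : ℝ} (hc : ∀ᶠ t in 𝓝 t₀, ContinuousAt c t) :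
    ∃ S : ℝ → ℝ, S t₀ = 0 ∧ ∀ᶠ t in 𝓝 t₀, HasDerivAt S (c t) t := by
  obtain ⟨ε, hε, h⟩ := Metric.eventually_nhds_iff_ball.1 hc
  have hon : ContinuousOn c (Metric.ball t₀ ε) := fun t ht => (h t ht).continuousWithinAt
  refine ⟨fun t => ∫ s in t₀..t, c s, intervalIntegral.integral_same, ?_⟩
  filter_upwards [Metric.ball_mem_nhds t₀ hε] with t ht
  refine intervalIntegral.integral_hasDerivAt_right ?_
    (hon.stronglyMeasurableAtFilter Metric.isOpen_ball t ht) (h t ht)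
  refine (hon.mono ?_).intervalIntegrable
  rw [← segment_eq_uIcc]
  exact (convex_ball t₀ ε).segment_subset (Metric.mem_ball_self hε) ht

/-- A curve that follows a vector field up to a time change runs through the integral curve. -/
lemma eventually_of_time_change {Y : ℂ → ℂ} {x σ : ℝ → ℂ} {c : ℝ → ℝ} {t₀ : ℝ}
    (hc : ∀ᶠ t in 𝓝 t₀, ContinuousAt c t) (hc0 : c t₀ ≠ 0) (hY : ContDiffAt ℝ 1 Y (x t₀))
    (hx : ∀ᶠ t in 𝓝 t₀, HasDerivAt x ((c t : ℂ) * Y (x t)) t) (hσ0 : σ 0 = x t₀)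
    (hσ : ∀ᶠ s in 𝓝 0, HasDerivAt σ (Y (σ s)) s) {P : ℂ → Prop} (hP : ∀ᶠ t in 𝓝 t₀, P (x t)) :
    ∀ᶠ s in 𝓝 0, P (σ s) := by
  obtain ⟨S, hS0, hS⟩ := exists_primitive hc
  have hSs : HasStrictDerivAt S (c t₀) t₀ :=
    hasStrictDerivAt_of_hasDerivAt_of_continuousAt hS hc.self_of_nhds
  -- The new time covers a full neighbourhood of `0` since `c t₀ ≠ 0`; this carries the property
  -- from `x` to all nearby points of `σ`.
  have hmap : map S (𝓝 t₀) = 𝓝 0 := hS0 ▸ hSs.map_nhds_eq hc0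
  have hSt : Tendsto S (𝓝 t₀) (𝓝 0) := hmap.le
  obtain ⟨K, U, hU, hK⟩ := hY.exists_lipschitzOnWith
  obtain ⟨M, hM⟩ : ∃ M : NNReal, |c t₀| < M :=
    ⟨⟨|c t₀| + 1, by positivity⟩, lt_add_one |c t₀|⟩
  have hσc : ContinuousAt σ 0 := hσ.self_of_nhds.continuousAt
  have hxc : ContinuousAt x t₀ := hx.self_of_nhds.continuousAt
  have heq : x =ᶠ[𝓝 t₀] fun t => σ (S t) := by
    refine ODE_solution_unique_of_eventually (v := fun t y => (c t : ℂ) * Y y) (s := fun _ => U)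
      (K := M * K) ?_ ?_ ?_ (by rw [hS0, hσ0])
    · have hb : ∀ᶠ t in 𝓝 t₀, |c t| < M :=
        hc.self_of_nhds.abs.eventually (gt_mem_nhds hM)
      filter_upwards [hb] with t ht
      refine LipschitzOnWith.of_dist_le_mul fun y hy z hz => ?_
      have := hK.dist_le_mul y hy z hz
      rw [dist_eq_norm, ← mul_sub, norm_mul, Complex.norm_real, Real.norm_eq_abs, ← dist_eq_norm,
        NNReal.coe_mul, mul_assoc]
      exact mul_le_mul ht.le this dist_nonneg M.coe_nonneg
    · filter_upwards [hx, hxc.eventually_mem hU] with t h1 h2 using ⟨h1, h2⟩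
    · have hσU : ∀ᶠ s in 𝓝 0, σ s ∈ U := hσc.eventually_mem (hσ0 ▸ hU)
      filter_upwards [hS, hSt.eventually hσ, hSt.eventually hσU] with t h1 h2 h3
      refine ⟨?_, h3⟩
      have := h2.scomp t h1
      rwa [Complex.real_smul] at this
  rw [← hmap, eventually_map]
  filter_upwards [hP, heq] with t h1 h2
  rwa [← h2]

/-! ### Harmonic oscillations -/

/-- Near `0`, `l` is a harmonic oscillation of frequency `ω` about some mean value. -/
def IsOscillation (ω : ℝ) (l : ℝ → ℝ) : Prop :=
  ∃ (A : ℝ) (β : ℂ), ∀ᶠ s : ℝ in 𝓝 0, l s = A + (β * Complex.exp (Complex.I * (ω * s))).re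

/-- The quantity `(l' + iω(l - A)) e^{-iωs}` is conserved, and `l - A` is recovered as a real part.
-/
lemma isOscillation_of_hasDerivAt {ω A : ℝ} (hω : ω ≠ 0) {l l' : ℝ → ℝ}
    (h1 : ∀ᶠ s in 𝓝 0, HasDerivAt l (l' s) s)
    (h2 : ∀ᶠ s in 𝓝 0, HasDerivAt l' (ω ^ 2 * (A - l s)) s) : IsOscillation ω l := by
  set E : ℝ → ℂ := fun s => ((l' s : ℂ) + Complex.I * (ω * ((l s : ℂ) - A)))
    * Complex.exp (-(Complex.I * (ω * s))) with hE
  have hconst : ∀ᶠ s in 𝓝 0, E s = E 0 := by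
    refine eventually_eq_of_hasDerivAt_zero ?_
    filter_upwards [h1, h2] with s a1 a2
    have b0 : HasDerivAt (fun s : ℝ => (s : ℂ)) 1 s := Complex.ofRealCLM.hasDerivAt
    have b1 := ((b0.const_mul (ω : ℂ)).const_mul Complex.I).neg.cexp
    refine ((a2.ofReal_comp.add (((a1.ofReal_comp.sub_const (A : ℂ)).const_mul
      (ω : ℂ)).const_mul Complex.I)).mul b1).congr_deriv ?_
    simp only [Pi.add_apply, Pi.neg_apply]
    push_cast
    linear_combination (-(ω ^ 2 * ((l s : ℂ) - A) * Complex.exp (-(Complex.I * (ω * s)))))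
      * Complex.I_sq
  refine ⟨A, -Complex.I * E 0 / ω, ?_⟩
  filter_upwards [hconst] with s hs
  have e1 : E 0 * Complex.exp (Complex.I * (ω * s))
      = (l' s : ℂ) + Complex.I * (ω * ((l s : ℂ) - A)) := by
    rw [← hs, hE, mul_assoc, ← Complex.exp_add, neg_add_cancel, Complex.exp_zero, mul_one]
  have e2 : -Complex.I * E 0 / ω * Complex.exp (Complex.I * (ω * s))
      = ((l s - A : ℝ) : ℂ) - Complex.I * ((l' s / ω : ℝ) : ℂ) := by
    have : (ω : ℂ) ≠ 0 := by exact_mod_cast hω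
    calc _ = -Complex.I * (E 0 * Complex.exp (Complex.I * (ω * s))) / ω := by ring
      _ = _ := by
        rw [e1]; push_cast; field_simp
        linear_combination (-(ω * ((l s : ℂ) - A))) * Complex.I_sq
  rw [e2]
  simp

lemma IsOscillation.linear {ω : ℝ} {l l' : ℝ → ℝ} (h : IsOscillation ω l)
    (h' : IsOscillation ω l') (x y z : ℝ) : IsOscillation ω fun s => x + y * l s + z * l' s := by
  obtain ⟨A, β, e⟩ := h
  obtain ⟨A', β', e'⟩ := h'
  refine ⟨x + y * A + z * A', y * β + z * β', ?_⟩
  filter_upwards [e, e'] with s h h'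
  rw [h, h', add_mul, Complex.add_re, mul_assoc, mul_assoc, Complex.re_ofReal_mul,
    Complex.re_ofReal_mul]
  ring

open Polynomial in
lemma polynomial_eq_zero_of_eventually {ω : ℝ} (hω : ω ≠ 0) {P : ℂ[X]}
    (h : ∀ᶠ s : ℝ in 𝓝 0, P.eval (Complex.exp (Complex.I * (ω * s))) = 0) : P = 0 := by
  have hsmall : ∀ᶠ s : ℝ in 𝓝 0, ω * s ∈ Set.Ioo (-Real.pi) Real.pi := by
    have : ContinuousAt (fun s : ℝ => ω * s) 0 := by fun_prop
    exact this.eventually_mem (by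
      rw [mul_zero]; exact Ioo_mem_nhds (neg_lt_zero.2 Real.pi_pos) Real.pi_pos)
  have hmem := h.and hsmall
  refine P.eq_zero_of_infinite_isRoot
    (Set.Infinite.mono ?_ ((infinite_of_mem_nhds (0 : ℝ) hmem).image
      (f := fun s : ℝ => Complex.exp (Complex.I * (ω * s))) ?_))
  · rintro _ ⟨s, hs, rfl⟩
    exact hs.1
  · intro s hs t ht hst
    have him : ∀ r : ℝ, (Complex.I * (ω * r)).im = ω * r := fun r => by simp
    have := Complex.exp_inj_of_neg_pi_lt_of_le_pi (by rw [him]; exact hs.2.1)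
      (by rw [him]; exact hs.2.2.le) (by rw [him]; exact ht.2.1) (by rw [him]; exact ht.2.2.le) hst
    have := congrArg Complex.im this
    rw [him, him] at this
    exact mul_left_cancel₀ hω this

open Polynomial in
/-- A sum of multiples of the reciprocals of oscillations of the same frequency is not a nonzero
constant unless one of them is constant. -/
lemma exists_const_of_sum_div {ι : Type*} [DecidableEq ι] {ω : ℝ} (hω : ω ≠ 0) (S : Finset ι)
    (c : ι → ℝ) (l : ι → ℝ → ℝ) (hl : ∀ j ∈ S, IsOscillation ω (l j))
    (hpos : ∀ j ∈ S, ∀ᶠ s in 𝓝 0, 0 < l j s) {K : ℝ} (hK : K ≠ 0)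
    (h : ∀ᶠ s in 𝓝 0, ∑ j ∈ S, c j / l j s = K) :
    ∃ j ∈ S, ∀ᶠ s in 𝓝 0, l j s = l j 0 := by
  have hl' : ∀ j, ∃ (A : ℝ) (β : ℂ), j ∈ S →
      ∀ᶠ s : ℝ in 𝓝 0, l j s = A + (β * Complex.exp (Complex.I * (ω * s))).re := by
    intro j
    by_cases hj : j ∈ S
    · obtain ⟨A, β, e⟩ := hl j hj
      exact ⟨A, β, fun _ => e⟩
    · exact ⟨0, 0, fun h => absurd h hj⟩
  choose A β e using hl'
  set Q : ι → ℂ[X] := fun j => C (β j / 2) * X ^ 2 + C (A j : ℂ) * X + C (conj (β j) / 2) with hQ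
  have hall : ∀ᶠ s : ℝ in 𝓝 0, ∀ j ∈ S, 0 < l j s ∧
      l j s = A j + (β j * Complex.exp (Complex.I * (ω * s))).re :=
    (Filter.eventually_all_finset S).2 fun j hj => (hpos j hj).and (e j hj)
  -- On the unit circle `Q j` takes the value `z l_j`, so this is the relation with denominators
  -- cleared; the factor `X` makes up for the missing index `j`.
  have hP : C (K : ℂ) * ∏ j ∈ S, Q j - X * ∑ j ∈ S, C (c j : ℂ) * ∏ i ∈ S.erase j, Q i = 0 := by
    refine polynomial_eq_zero_of_eventually hω ?_
    filter_upwards [h, hall] with s hs hs'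
    set z := Complex.exp (Complex.I * (ω * s)) with hz
    have hz0 : z ≠ 0 := Complex.exp_ne_zero _
    have hzz : conj z * z = 1 := by
      rw [hz, ← Complex.exp_conj, ← Complex.exp_add]
      simp
    have hQz : ∀ j ∈ S, (Q j).eval z = l j s * z := by
      intro j hj
      rw [(hs' j hj).2]
      have : (((β j * z).re : ℝ) : ℂ) = (β j * z + conj (β j) * conj z) / 2 := by
        rw [← map_mul, Complex.add_conj]; push_cast; ring
      push_cast
      rw [this]
      simp only [hQ, eval_add, eval_mul, eval_C, eval_pow, eval_X]
      linear_combination (-conj (β j) / 2) * hzz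
    rw [eval_sub, eval_mul, eval_mul, eval_C, eval_X, eval_prod, eval_finsetSum, ← hs]
    push_cast
    rw [Finset.sum_mul, Finset.mul_sum, ← Finset.sum_sub_distrib]
    refine Finset.sum_eq_zero fun j hj => ?_
    have hlj : (l j s : ℂ) ≠ 0 := by exact_mod_cast (hs' j hj).1.ne'
    rw [eval_mul, eval_C, eval_prod, ← Finset.mul_prod_erase S _ hj, hQz j hj]
    field_simp
    ring
  -- At `0` only `K ∏ Q_j(0)` survives, and `Q_j(0)` is half the conjugate of the amplitude `β j`.
  have h0 := congrArg (eval 0) hP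
  rw [eval_sub, eval_mul, eval_mul, eval_X, zero_mul, sub_zero, eval_C, eval_zero, mul_eq_zero,
    or_iff_right (by exact_mod_cast hK), eval_prod, Finset.prod_eq_zero_iff] at h0
  obtain ⟨j, hj, hj0⟩ := h0
  have hβ : β j = 0 := by simpa [hQ] using hj0
  refine ⟨j, hj, ?_⟩
  have hj' := e j hj
  rw [hβ] at hj'
  have h00 := hj'.self_of_nhds
  filter_upwards [hj'] with s hs
  rw [hs, h00]; simp

/-- A constant term can be removed and the argument repeated: positivity of the remaining terms
keeps the constant nonzero until no term is left. -/
lemma const_of_sum_div {ι : Type*} [DecidableEq ι] {ω : ℝ} (hω : ω ≠ 0) (c : ι → ℝ)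
    (l : ι → ℝ → ℝ) (S : Finset ι) (hc : ∀ j ∈ S, 0 < c j) (hl : ∀ j ∈ S, IsOscillation ω (l j))
    (hpos : ∀ j ∈ S, ∀ᶠ s in 𝓝 0, 0 < l j s) {K : ℝ}
    (h : ∀ᶠ s in 𝓝 0, ∑ j ∈ S, c j / l j s = K) :
    ∀ j ∈ S, ∀ᶠ s in 𝓝 0, l j s = l j 0 := by
  induction S using Finset.strongInduction generalizing K with
  | H S ih =>
    intro j hj
    have hK : K ≠ 0 := by
      rw [← h.self_of_nhds]
      exact (Finset.sum_pos (fun i hi => div_pos (hc i hi) (hpos i hi).self_of_nhds) ⟨j, hj⟩).ne'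
    obtain ⟨i, hi, hil⟩ := exists_const_of_sum_div hω S c l hl hpos hK h
    by_cases hij : j = i
    · rwa [hij]
    · refine ih (S.erase i) (Finset.erase_ssubset hi) (fun k hk => hc k (Finset.mem_of_mem_erase hk))
        (fun k hk => hl k (Finset.mem_of_mem_erase hk))
        (fun k hk => hpos k (Finset.mem_of_mem_erase hk)) (K := K - c i / l i 0) ?_ j
        (Finset.mem_erase.2 ⟨hij, hj⟩)
      filter_upwards [h, hil] with s hs hs'
      rw [← hs, ← Finset.add_sum_erase S _ hi, hs']
      ring

end PlanarBody
end

noncomputable section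

namespace PlanarBody

open ComplexConjugate Filter Topology

/-! ### The strong force potential -/

/-- Along a curve of constant geodesic curvature on the sphere, the coordinate functions oscillate
harmonically. -/
lemma isOscillation_of_circle {s₁ s₂ n₁ n₂ : ℝ → ℝ} {x y κ : ℝ} (hx : 0 < x) (hy : 0 < y)
    (hn : ∀ᶠ s in 𝓝 0, n₁ s ^ 2 + n₂ s ^ 2 = 1)
    (h1 : ∀ᶠ s in 𝓝 0, HasDerivAt s₁ (-((x + y * (s₁ s ^ 2 + s₂ s ^ 2)) * n₂ s)) s)
    (h2 : ∀ᶠ s in 𝓝 0, HasDerivAt s₂ ((x + y * (s₁ s ^ 2 + s₂ s ^ 2)) * n₁ s) s)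
    (h3 : ∀ᶠ s in 𝓝 0,
      HasDerivAt n₁ (-((κ + 2 * y * (s₁ s * n₁ s + s₂ s * n₂ s)) * n₂ s)) s)
    (h4 : ∀ᶠ s in 𝓝 0,
      HasDerivAt n₂ ((κ + 2 * y * (s₁ s * n₁ s + s₂ s * n₂ s)) * n₁ s) s) :
    IsOscillation (Real.sqrt (κ ^ 2 + 4 * x * y)) (fun s => 1 / (x + y * (s₁ s ^ 2 + s₂ s ^ 2))) ∧
    IsOscillation (Real.sqrt (κ ^ 2 + 4 * x * y))
      (fun s => s₁ s / (x + y * (s₁ s ^ 2 + s₂ s ^ 2))) := by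
  set R : ℝ → ℝ := fun s => x + y * (s₁ s ^ 2 + s₂ s ^ 2) with hR
  set P : ℝ → ℝ := fun s => s₁ s * n₁ s + s₂ s * n₂ s with hP
  set M : ℝ → ℝ := fun s => s₁ s * n₂ s - s₂ s * n₁ s with hM
  have hRpos : ∀ s, 0 < R s := fun s => by simp only [hR]; positivity
  have hω2 : Real.sqrt (κ ^ 2 + 4 * x * y) ^ 2 = κ ^ 2 + 4 * x * y := Real.sq_sqrt (by positivity)
  have hω : Real.sqrt (κ ^ 2 + 4 * x * y) ≠ 0 := (Real.sqrt_pos.2 (by positivity)).ne'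
  generalize Real.sqrt (κ ^ 2 + 4 * x * y) = ω at *
  have hPM : ∀ᶠ s in 𝓝 0, y * (P s ^ 2 + M s ^ 2) = R s - x := by
    filter_upwards [hn] with s hs
    simp only [hP, hM, hR]
    linear_combination y * (s₁ s ^ 2 + s₂ s ^ 2) * hs
  have dR : ∀ᶠ s in 𝓝 0, HasDerivAt R (-(2 * y * R s * M s)) s := by
    filter_upwards [h1, h2] with s a1 a2
    refine ((((a1.pow 2).add (a2.pow 2)).const_mul y).const_add x).congr_deriv ?_
    simp only [hM, hR]; push_cast; ring
  have dP : ∀ᶠ s in 𝓝 0, HasDerivAt P (-((κ + 2 * y * P s) * M s)) s := by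
    filter_upwards [h1, h2, h3, h4] with s a1 a2 a3 a4
    refine ((a1.mul a3).add (a2.mul a4)).congr_deriv ?_
    simp only [hM, hP]; ring
  have dM : ∀ᶠ s in 𝓝 0, HasDerivAt M (-R s + (κ + 2 * y * P s) * P s) s := by
    filter_upwards [h1, h2, h3, h4, hn] with s a1 a2 a3 a4 a5
    refine ((a1.mul a4).sub (a2.mul a3)).congr_deriv ?_
    simp only [hP, hR]
    linear_combination (-(x + y * (s₁ s ^ 2 + s₂ s ^ 2))) * a5
  -- the conserved data of the osculating circle
  have hA : ∀ᶠ s in 𝓝 0, (κ + 2 * y * P s) / R s = (κ + 2 * y * P 0) / R 0 := by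
    refine eventually_eq_of_hasDerivAt_zero (f := fun s => (κ + 2 * y * P s) / R s) ?_
    filter_upwards [dR, dP] with s aR aP
    refine (((aP.const_mul (2 * y)).const_add κ).div aR (hRpos s).ne').congr_deriv ?_
    have := (hRpos s).ne'
    field_simp; ring
  generalize (κ + 2 * y * P 0) / R 0 = A at hA
  have hA' : ∀ᶠ s in 𝓝 0, κ + 2 * y * P s = A * R s := by
    filter_upwards [hA] with s hs
    rwa [div_eq_iff (hRpos s).ne'] at hs
  have hb : ∀ᶠ s in 𝓝 0, n₁ s - A * s₁ s = n₁ 0 - A * s₁ 0 := by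
    refine eventually_eq_of_hasDerivAt_zero (f := fun s => n₁ s - A * s₁ s) ?_
    filter_upwards [h1, h3, hA'] with s a1 a3 aA
    refine (a3.sub (a1.const_mul A)).congr_deriv ?_
    simp only [hP, hR] at aA
    linear_combination (-n₂ s) * aA
  generalize n₁ 0 - A * s₁ 0 = b at hb
  have hω2' : ω ^ 2 ≠ 0 := pow_ne_zero 2 hω
  have df : ∀ᶠ s in 𝓝 0, HasDerivAt (fun s => 1 / R s) (2 * y * (M s / R s)) s := by
    filter_upwards [dR] with s aR
    refine ((hasDerivAt_const s (1 : ℝ)).div aR (hRpos s).ne').congr_deriv ?_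
    have := (hRpos s).ne'
    field_simp; ring
  -- The frequency appears here: `y(P² + M²) = R - x` and `κ + 2yP = AR` eliminate `P` and `M`,
  -- leaving `κ² + 4xy` as the coefficient of `-1 / R`.
  have df' : ∀ᶠ s in 𝓝 0, HasDerivAt (fun s => 2 * y * (M s / R s))
      (2 * y + κ * A - ω ^ 2 / R s) s := by
    filter_upwards [dR, dM, hA', hPM] with s aR aM aA aPM
    refine ((aM.div aR (hRpos s).ne').const_mul (2 * y)).congr_deriv ?_
    have := (hRpos s).ne'
    rw [hω2]
    field_simp
    linear_combination 4 * y * aPM + κ * aA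
  constructor
  · refine isOscillation_of_hasDerivAt (A := (2 * y + κ * A) / ω ^ 2) hω df ?_
    filter_upwards [df'] with s a
    refine a.congr_deriv ?_
    have := (hRpos s).ne'
    change _ = ω ^ 2 * ((2 * y + κ * A) / ω ^ 2 - 1 / R s)
    field_simp
  · refine isOscillation_of_hasDerivAt (A := -κ * b / ω ^ 2)
      (l' := fun s => -n₂ s + s₁ s * (2 * y * (M s / R s))) hω ?_ ?_
    · filter_upwards [h1, dR] with s a1 aR
      refine (a1.div aR (hRpos s).ne').congr_deriv ?_
      have := (hRpos s).ne'
      change (-(R s * n₂ s) * R s - _) / _ = _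
      field_simp; ring
    · filter_upwards [h1, h4, df', hb, hA', hn] with s a1 a4 a' ab aA an
      refine (a4.neg.add (a1.mul a')).congr_deriv ?_
      have := (hRpos s).ne'
      change -((κ + 2 * y * P s) * n₁ s) + (-(R s * n₂ s) * (2 * y * (M s / R s)) + _) = _
      field_simp
      rw [← ab]
      simp only [hP, hM]
      linear_combination (-2 * y * s₁ s * R s ^ 2) * an

variable {m : Fin 3 → ℝ}

/-- For the strong force potential, the level curves have nowhere constant geodesic curvature. -/
lemma not_eventually_const_levelCurvature (hm : ∀ k, 0 < m k) {σ : ℝ → ℂ} {κ : ℝ}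
    (hr : ∀ᶠ s in 𝓝 0, IsRegularShape m 2 (σ s))
    (hσ : ∀ᶠ s in 𝓝 0, HasDerivAt σ (levelField m 2 (σ s)) s)
    (hκ : ∀ᶠ s in 𝓝 0, levelCurvature m 2 (σ s) = κ) : False := by
  have hx := innerMass_pos hm
  have hy := outerMass_pos hm
  set N : ℝ → ℂ := fun s => unitGrad m 2 (σ s) with hN
  have hRe : ∀ s, shapeInertia m (σ s)
      = innerMass m + outerMass m * ((σ s).re ^ 2 + (σ s).im ^ 2) := fun s => by
    rw [shapeInertia, Complex.sq_norm, Complex.normSq_apply]; ring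
  have hRpos := fun s => shapeInertia_pos hm (σ s)
  have hn : ∀ᶠ s in 𝓝 0, (N s).re ^ 2 + (N s).im ^ 2 = 1 := by
    filter_upwards [hr] with s hs
    have := congrArg Complex.re (conj_mul_unitGrad hs.2.2)
    simp only [Complex.mul_re, Complex.conj_re, Complex.conj_im, Complex.one_re] at this
    simp only [hN]; linarith
  have h1 : ∀ᶠ s in 𝓝 0, HasDerivAt (fun s => (σ s).re) (-(shapeInertia m (σ s) * (N s).im)) s := by
    filter_upwards [hσ] with s hs
    refine (hasDerivAt_re hs).congr_deriv ?_
    simp [levelField, hN]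
  have h2 : ∀ᶠ s in 𝓝 0, HasDerivAt (fun s => (σ s).im) (shapeInertia m (σ s) * (N s).re) s := by
    filter_upwards [hσ] with s hs
    refine (hasDerivAt_im hs).congr_deriv ?_
    simp [levelField, hN]
  have hNd : ∀ᶠ s in 𝓝 0, HasDerivAt N (Complex.I * ((κ + 2 * outerMass m *
      ((σ s).re * (N s).re + (σ s).im * (N s).im) : ℝ) : ℂ) * N s) s := by
    filter_upwards [hσ, hr, hκ] with s hs hrs hκs
    have := hasDerivAt_comp_levelField (c := 1) (x := σ) (contDiffAt_unitGrad hrs) (by simpa using hs)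
    refine this.congr_deriv ?_
    rw [one_smul, alongLevel_unitGrad hrs]
    have e : turning m 2 (σ s) = κ + 2 * outerMass m *
      ((σ s).re * (N s).re + (σ s).im * (N s).im) := by
      rw [← hκs, levelCurvature]; simp [hN]
    rw [e]
  obtain ⟨o1, o2⟩ := isOscillation_of_circle (κ := κ) hx hy hn
    (by simpa only [hRe] using h1) (by simpa only [hRe] using h2)
    (by filter_upwards [hNd] with s hs
        refine (hasDerivAt_re hs).congr_deriv ?_
        rw [mul_assoc, Complex.I_mul_re, Complex.im_ofReal_mul])
    (by filter_upwards [hNd] with s hs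
        refine (hasDerivAt_im hs).congr_deriv ?_
        rw [mul_assoc, Complex.I_mul_im, Complex.re_ofReal_mul])
  set ω := Real.sqrt (κ ^ 2 + 4 * innerMass m * outerMass m)
  have hω : ω ≠ 0 := (Real.sqrt_pos.2 (by positivity)).ne'
  simp only [← hRe] at o1 o2
  -- The squared mutual distances divided by the moment of inertia. The collision points lie on the
  -- real axis, so these are affine in `1 / R` and `Re σ / R`, and the imaginary coordinate is not
  -- needed.
  set l : Fin 3 → ℝ → ℝ := ![fun s => 1 / shapeInertia m (σ s),
    fun s => ‖σ s + weight₁ m‖ ^ 2 / shapeInertia m (σ s),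
    fun s => ‖σ s - weight₀ m‖ ^ 2 / shapeInertia m (σ s)] with hl
  set c : Fin 3 → ℝ := ![m 0 * m 1, m 0 * m 2, m 1 * m 2] with hc
  have e1 : l 1 = fun s => 1 / outerMass m + (weight₁ m ^ 2 - innerMass m / outerMass m)
      * (1 / shapeInertia m (σ s)) + 2 * weight₁ m * ((σ s).re / shapeInertia m (σ s)) := by
    funext s
    have := (hRpos s).ne'
    simp only [hl, Matrix.cons_val_one, Matrix.cons_val_zero]
    field_simp
    rw [hRe, Complex.sq_norm, Complex.normSq_apply]
    simp; ring
  have e2 : l 2 = fun s => 1 / outerMass m + (weight₀ m ^ 2 - innerMass m / outerMass m)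
      * (1 / shapeInertia m (σ s)) + -2 * weight₀ m * ((σ s).re / shapeInertia m (σ s)) := by
    funext s
    have := (hRpos s).ne'
    simp only [hl, Matrix.cons_val]
    field_simp
    rw [hRe, Complex.sq_norm, Complex.normSq_apply]
    simp; ring
  have hosc : ∀ j ∈ Finset.univ, IsOscillation ω (l j) := by
    intro j _
    fin_cases j
    · exact o1
    · exact e1 ▸ o1.linear o2 _ _ _
    · exact e2 ▸ o1.linear o2 _ _ _
  have hpos : ∀ j ∈ Finset.univ, ∀ᶠ s in 𝓝 0, 0 < l j s := by
    intro j _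
    filter_upwards [hr] with s hs
    have := hRpos s
    have := norm_pos_iff.2 hs.1
    have := norm_pos_iff.2 hs.2.1
    fin_cases j <;> simp [hl] <;> positivity
  have hcpos : ∀ j ∈ Finset.univ, 0 < c j := by
    intro j _
    have := hm 0; have := hm 1; have := hm 2
    fin_cases j <;> simp [hc] <;> positivity
  have hμ : ∀ᶠ s in 𝓝 0, shapeMeasure m 2 (σ s) = shapeMeasure m 2 (σ 0) := by
    refine eventually_eq_of_hasDerivAt_zero (f := fun s => shapeMeasure m 2 (σ s)) ?_
    filter_upwards [hr, hσ] with s hs hσs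
    refine (hasDerivAt_shapeMeasure hm two_pos hs.1 hs.2.1 hσs).congr_deriv ?_
    have : conj (shapeGrad m 2 (σ s)) * levelField m 2 (σ s)
        = ((‖shapeGrad m 2 (σ s)‖ * shapeInertia m (σ s) : ℝ) : ℂ) * Complex.I := by
      conv_lhs => rw [← norm_mul_unitGrad hs.2.2, map_mul, Complex.conj_ofReal, levelField]
      push_cast
      linear_combination (‖shapeGrad m 2 (σ s)‖ * shapeInertia m (σ s) * Complex.I : ℂ)
        * conj_mul_unitGrad hs.2.2
    rw [this, Complex.re_ofReal_mul, Complex.I_re, mul_zero, mul_zero]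
  have hsum : ∀ᶠ s in 𝓝 0, ∑ j, c j / l j s = 2 * shapeMeasure m 2 (σ 0) := by
    filter_upwards [hμ, hr] with s hs hrs
    have := (hRpos s).ne'
    have := norm_ne_zero_iff.2 hrs.1
    have := norm_ne_zero_iff.2 hrs.2.1
    rw [← hs, shapeMeasure, div_self two_ne_zero, Real.rpow_one, Real.rpow_two, Real.rpow_two,
      Fin.sum_univ_three]
    simp only [hc, hl, Matrix.cons_val]
    field_simp
  have hconst := const_of_sum_div hω c l Finset.univ hcpos hosc hpos hsum
  have hf : ∀ᶠ s in 𝓝 0, 1 / shapeInertia m (σ s) = 1 / shapeInertia m (σ 0) :=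
    hconst 0 (Finset.mem_univ _)
  have hR0 : ∀ᶠ s in 𝓝 0, shapeInertia m (σ s) = shapeInertia m (σ 0) := by
    filter_upwards [hf] with s hs
    rwa [one_div, one_div, inv_inj] at hs
  have hre : ∀ᶠ s in 𝓝 0, (σ s).re = (σ 0).re := by
    have hβ : weight₁ m ≠ 0 := (div_pos (hm 1) (add_pos (hm 0) (hm 1))).ne'
    filter_upwards [hR0, hconst 1 (Finset.mem_univ _)] with s hs hs'
    rw [e1] at hs'
    simp only [hs] at hs'
    have h' := (hRpos 0).ne'
    rw [add_right_inj, mul_right_inj' (mul_ne_zero two_ne_zero hβ), div_left_inj' h'] at hs'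
    exact hs'
  -- Constant `Re σ` and constant `R` stop the motion: the first gives `Im N = 0`, the second then
  -- gives `Im σ = 0`, whose derivative gives `Re N = 0`, against `|N| = 1`.
  have hre0 : ∀ᶠ s in 𝓝 0, (N s).im = 0 := by
    filter_upwards [h1, hre.eventually_nhds] with s a b
    have := a.unique ((hasDerivAt_const s (σ 0).re).congr_of_eventuallyEq b)
    simpa [(hRpos s).ne'] using this
  have him : ∀ᶠ s in 𝓝 0, (σ s).im = 0 := by
    filter_upwards [h2, hre, hre0, hn, hR0.eventually_nhds, hσ] with s a b b' d e f
    have := (hasDerivAt_shapeInertia (m := m) f).unique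
      ((hasDerivAt_const s (shapeInertia m (σ 0))).congr_of_eventuallyEq e)
    have hN1 : (N s).re ≠ 0 := by
      intro h0; rw [h0, b'] at d; norm_num at d
    have e3 : (conj (σ s) * levelField m 2 (σ s)).re
        = shapeInertia m (σ s) * ((σ s).im * (N s).re - (σ s).re * (N s).im) := by
      simp [levelField, hN]; ring
    rw [e3, b', mul_zero, sub_zero] at this
    simpa [hy.ne', (hRpos s).ne', hN1] using this
  have := h2.self_of_nhds.unique ((hasDerivAt_const (0 : ℝ) (0 : ℝ)).congr_of_eventuallyEq him)
  have h0 : (N 0).re = 0 := by simpa [(hRpos 0).ne'] using this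
  have := hn.self_of_nhds
  rw [h0, hre0.self_of_nhds] at this
  norm_num at this

/-- For `a = 2` the normal equation contains no power of `I`, so its derivative is a condition on
the level curve alone. The time change transfers it to the fixed integral curve `σ`, where different
motions can be compared. -/
lemma IsSolution.eventually_alongLevel {J : Set ℝ} {q p : ℝ → Fin 3 → ℂ}
    (h : IsSolution m 2 J q p) (hm : ∀ k, 0 < m k) (hJ : IsOpen J) {t₀ : ℝ} (ht₀ : t₀ ∈ J) {μ : ℝ}
    (hμ : ∀ s ∈ J, configMeasure m 2 (q s) = μ) (hr : IsRegularShape m 2 (shape m (q t₀)))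
    (hB : 0 < integralB m 2 q p t₀ - angularMomentum (q t₀) (p t₀) ^ 2)
    {σ : ℝ → ℂ} (hσ0 : σ 0 = shape m (q t₀))
    (hσ : ∀ᶠ s in 𝓝 0, HasDerivAt σ (levelField m 2 (σ s)) s) :
    ∃ τ : ℝ, innerMass m * outerMass m * τ ^ 2
        = integralB m 2 q p t₀ - angularMomentum (q t₀) (p t₀) ^ 2 ∧
      ∀ᶠ s in 𝓝 0, alongLevel m 2 (slope m 2) (σ s)
        + τ ^ 2 * alongLevel m 2 (levelCurvature m 2) (σ s) = 0 := by
  obtain ⟨τ, hτ, hτB, hev⟩ := h.reduced_motion hm two_pos hJ ht₀ hμ hr hB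
  refine ⟨τ, hτB, ?_⟩
  have hreg := h.eventually_isRegularShape ht₀ hr
  have hJn := hJ.mem_nhds ht₀
  refine eventually_of_time_change (x := fun t => shape m (q t))
    (c := fun t => τ / inertia m (q t)) ?_ ?_ ((contDiffAt_levelField hr).of_le (by simp))
    (hev.mono fun t ht => ht.1) hσ0 hσ
    (P := fun z => alongLevel m 2 (slope m 2) z + τ ^ 2 * alongLevel m 2 (levelCurvature m 2) z = 0)
    ?_
  · filter_upwards [hJn] with t ht
    exact continuousAt_const.div (h.hasDerivAt_inertia hm ht).continuousAt
      (inertia_pos hm (h.configuration t ht).1).ne'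
  · exact div_ne_zero hτ (inertia_pos hm (h.configuration t₀ ht₀).1).ne'
  · filter_upwards [hJn, hreg, hev.eventually_nhds] with t ht hrt hevt
    have hI := inertia_pos hm (h.configuration t ht).1
    have hs := hevt.self_of_nhds.1
    have d1 := hasDerivAt_comp_levelField (x := fun s => shape m (q s)) (contDiffAt_slope hm hrt) hs
    have d2 := (hasDerivAt_comp_levelField (x := fun s => shape m (q s))
      (contDiffAt_levelCurvature hrt) hs).const_mul (τ ^ 2)
    have d := (d1.add d2).unique ((hasDerivAt_const t
      (-2 * τ * angularMomentum (q t₀) (p t₀))).congr_of_eventuallyEq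
        (hevt.mono fun s hs => by
          have := hs.2
          rw [sub_self, zero_div, Real.rpow_zero, one_mul] at this
          exact this))
    simp only [smul_eq_mul] at d
    have hc : τ / inertia m (q t) ≠ 0 := div_ne_zero hτ hI.ne'
    refine ((mul_eq_zero (a := τ / inertia m (q t))).1 ?_).resolve_left hc
    linear_combination d

/-- Two distinct positive values of `B - C²` make the curvature constant along the level curve,
which `not_eventually_const_levelCurvature` forbids. -/
theorem exists_bound_of_eq_two (hm : ∀ k, 0 < m k) {q₀ : Fin 3 → ℂ}
    (hr : IsRegularShape m 2 (shape m q₀)) :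
    ∃ δ > 0, ∀ (J : Set ℝ) (t₀ : ℝ) (q p : ℝ → Fin 3 → ℂ), IsOpen J → t₀ ∈ J →
      IsSolution m 2 J q p → q t₀ = q₀ →
      (∀ t ∈ J, configMeasure m 2 (q t) = configMeasure m 2 (q t₀)) →
      0 < integralB m 2 q p t₀ - angularMomentum (q t₀) (p t₀) ^ 2 →
      δ ≤ integralB m 2 q p t₀ - angularMomentum (q t₀) (p t₀) ^ 2 := by
  by_contra! hno
  obtain ⟨σ, hσ0, ε, hε, hσ⟩ := ((contDiffAt_levelField hr).of_le
    (by simp)).exists_forall_mem_closedBall_exists_eq_forall_mem_Ioo_hasDerivAt₀ 0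
  have hσ : ∀ᶠ s in 𝓝 0, HasDerivAt σ (levelField m 2 (σ s)) s := by
    filter_upwards [Ioo_mem_nhds (a := 0 - ε) (b := 0 + ε) (by linarith) (by linarith)] with s hs
      using hσ s hs
  obtain ⟨J₁, t₁, q₁, p₁, hJ₁, ht₁, hs₁, hq₁, hμ₁, hB₁, -⟩ := hno 1 one_pos
  -- The value attained by the first motion serves as the next bound, so the second motion has a
  -- strictly smaller one and `τ₁² ≠ τ₂²`.
  obtain ⟨J₂, t₂, q₂, p₂, hJ₂, ht₂, hs₂, hq₂, hμ₂, hB₂, hlt⟩ := hno _ hB₁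
  obtain ⟨τ₁, e₁, h₁⟩ := hs₁.eventually_alongLevel hm hJ₁ ht₁ hμ₁ (hq₁ ▸ hr) hB₁ (hq₁ ▸ hσ0) hσ
  obtain ⟨τ₂, e₂, h₂⟩ := hs₂.eventually_alongLevel hm hJ₂ ht₂ hμ₂ (hq₂ ▸ hr) hB₂ (hq₂ ▸ hσ0) hσ
  rw [← e₁, ← e₂] at hlt
  have hne : τ₁ ^ 2 - τ₂ ^ 2 ≠ 0 := by
    intro h0
    rw [sub_eq_zero.1 h0] at hlt
    exact lt_irrefl _ hlt
  have hreg : ∀ᶠ s in 𝓝 0, IsRegularShape m 2 (σ s) := by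
    have hc : Tendsto σ (𝓝 0) (𝓝 (shape m q₀)) := by
      rw [← hσ0]; exact hσ.self_of_nhds.continuousAt
    exact hc.eventually hr.eventually
  refine not_eventually_const_levelCurvature hm hreg hσ (eventually_eq_of_hasDerivAt_zero
    (f := fun s => levelCurvature m 2 (σ s)) ?_)
  filter_upwards [hreg, hσ, h₁, h₂] with s a b c d
  have hk : alongLevel m 2 (levelCurvature m 2) (σ s) = 0 := by
    refine ((mul_eq_zero (a := τ₁ ^ 2 - τ₂ ^ 2)).1 ?_).resolve_left hne
    linear_combination c - d
  have := hasDerivAt_comp_levelField (c := 1) (x := σ) (contDiffAt_levelCurvature a)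
    (by simpa using b)
  rwa [one_smul, hk] at this

end PlanarBody
end

/-! ### The two cases `a = 2` and `a ≠ 2` combined. -/

theorem theorem7 (m : Fin 3 → ℝ) (hm : ∀ k, 0 < m k) (a : ℝ) (ha : 0 < a)
    (q₀ : Fin 3 → ℂ) (hq₀ : PlanarBody.IsConfiguration m q₀)
    (hcentral : ¬ PlanarBody.IsCentral m a q₀) :
    ∃ δ : ℝ, 0 < δ ∧
      ¬ ∃ (J : Set ℝ) (t₀ : ℝ) (q p : ℝ → Fin 3 → ℂ),
        IsOpen J ∧ J.OrdConnected ∧ t₀ ∈ J ∧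
        PlanarBody.IsSolution m a J q p ∧
        q t₀ = q₀ ∧
        (∀ t ∈ J, PlanarBody.configMeasure m a (q t) = PlanarBody.configMeasure m a (q t₀)) ∧
        0 < PlanarBody.integralB m a q p t₀
              - PlanarBody.angularMomentum (q t₀) (p t₀) ^ 2 ∧
        PlanarBody.integralB m a q p t₀
              - PlanarBody.angularMomentum (q t₀) (p t₀) ^ 2 < δ := by
  have hr : PlanarBody.IsRegularShape m a (PlanarBody.shape m q₀) :=
    ⟨(PlanarBody.shape_ne hm hq₀.1).1, (PlanarBody.shape_ne hm hq₀.1).2, fun h0 =>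
      hcentral (PlanarBody.isCentral_of_shapeGrad_eq_zero hm ha hq₀ h0)⟩
  obtain ⟨δ, hδ, h⟩ : ∃ δ > 0, ∀ (J : Set ℝ) (t₀ : ℝ) (q p : ℝ → Fin 3 → ℂ), IsOpen J → t₀ ∈ J →
      PlanarBody.IsSolution m a J q p → q t₀ = q₀ →
      (∀ t ∈ J, PlanarBody.configMeasure m a (q t) = PlanarBody.configMeasure m a (q t₀)) →
      0 < PlanarBody.integralB m a q p t₀ - PlanarBody.angularMomentum (q t₀) (p t₀) ^ 2 →
      δ ≤ PlanarBody.integralB m a q p t₀ - PlanarBody.angularMomentum (q t₀) (p t₀) ^ 2 := by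
    by_cases ha2 : a = 2
    · subst ha2
      exact PlanarBody.exists_bound_of_eq_two hm hr
    · exact PlanarBody.exists_bound_of_ne_two hm ha ha2 hq₀ hr
  refine ⟨δ, hδ, ?_⟩
  rintro ⟨J, t₀, q, p, hJ, -, ht₀, hs, hq, hμ, hB, hlt⟩
  exact absurd (h J t₀ q p hJ ht₀ hs hq hμ hB) (not_le.2 hlt)
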